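/- Let $m\le n$, let $\mathbb{R}^{m\times n}$ carry the trace inner product $\langle X,Y\rangle=\mathrm{tr}(X^{\top}Y)$ and the Frobenius norm, let $\sigma_1(X)\ge\dots\ge\sigma_m(X)\ge 0$ be the singular values of $X$ and $\|X\|_*=\sum_{i=1}^m\sigma_i(X)$. In Euclidean spaces, $\widehat\partial g$ and $\partial g$ denote the regular (Fréchet) and the limiting (Mordukhovich) subdifferential of an extended real-valued function $g$, $\mathcal N_S$ the limiting normal cone to a set $S$ (empty at points outside $S$), and, for a multifunction $\mathcal F$, $u\in D^*\mathcal F(\bar z|\bar w)(v)$ means $(u,-v)\in\mathcal N_{\mathrm{gph}\,\mathcal F}(\bar z,\bar w)$. Let $\nu>0$, let $\Omega\subseteq\mathbb{R}^{m\times n}$ be closed and convex, and let $f:\mathbb{R}^{m\times n}\to\mathbb{R}$ be locally Lipschitz with $\widehat\partial f(X)=\partial f(X)$ for all $X\in\Omega$. Let $\mathscr L_1$ be the family of proper lower semicontinuous convex functions $\phi:\mathbb{R}\to(-\infty,+\infty]$ with $[0,1]\subseteq\mathrm{int}(\mathrm{dom}\,\phi)$, $\phi(1)=1$, which have a minimizer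 $t^*<1$ over $[0,1]$ with $\phi(t^*)=0$, and which are differentiable at every point of $(0,1]$. For $\phi\in\mathscr L_1$ put $\widehat\phi(t)=\phi(|t|)$ and $(\widehat\Phi\circ\sigma)(W)=\sum_{i=1}^m\widehat\phi(\sigma_i(W))$. A matrix $\overline X$ is an M-stationary point, associated to $\phi$, of the problem $\min_{X\in\Omega}\{\nu f(X)+\mathrm{rank}(X)\}$ if there are $W\in\partial\|\cdot\|_*(\overline X)$ and $\Delta W\in\partial(\widehat\Phi\circ\sigma)(W)$ with $$0\in\nu\,\partial f(\overline X)+\mathcal N_\Omega(\overline X)+D^*\partial\|\cdot\|_*(\overline X|W)(\Delta W).$$ **Proposition.** Let $\overline X$ be an M-stationary point associated to $\phi\in\mathscr L_1$. Then there exist $\overline W\in\partial\|\cdot\|_*(\overline X)$ and $\Delta\Gamma\in\nu\,\partial f(\overline X)+\mathcal N_\Omega(\overline X)$ such that, with $\overline Z=\overline X+\overline W$ and $$\alpha=\{i\le m:\sigma_i(\overline Z)>1\},\quad \beta=\{i\le m:\sigma_i(\overline Z)=1\},\quad \gamma_1=\{i\le m:0<\sigma_i(\overline Z)<1\},\quad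 \gamma_0=\{i\le m:\sigma_i(\overline Z)=0\},$$ $\gamma=\gamma_1\cup\gamma_0$, $c=\{m+1,\dots,n\}$, the following hold. 1. For all orthogonal matrices $\overline U\in\mathbb{R}^{m\times m}$ and $\overline V\in\mathbb{R}^{n\times n}$ with $\overline Z=\overline U\,[\mathrm{Diag}(\sigma(\overline Z))\ \ 0]\,\overline V^{\top}$, the matrix $\Delta\widetilde\Gamma=\overline U^{\top}\Delta\Gamma\,\overline V$ (so that $\Delta\Gamma=\overline U\Delta\widetilde\Gamma\,\overline V^{\top}$) satisfies $$(\Delta\widetilde\Gamma)_{\alpha\alpha}=0,\ (\Delta\widetilde\Gamma)_{\alpha\beta}=0,\ (\Delta\widetilde\Gamma)_{\alpha\gamma}=0,\ (\Delta\widetilde\Gamma)_{\alpha c}=0,\ (\Delta\widetilde\Gamma)_{\beta\alpha}=0,\ (\Delta\widetilde\Gamma)_{\gamma\alpha}=0,$$ and $\tfrac12\big((\Delta\widetilde\Gamma)_{\beta\beta}+(\Delta\widetilde\Gamma)_{\beta\beta}^{\top}\big)=0$. 2. If $\phi'(t)\ne 0$ for all $t\in(0,1)$, then $\gamma_1=\emptyset$.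 3. If $0\notin\partial\widehat\phi(0)$, then $\gamma_0=\emptyset$. -/

import Mathlib

open scoped Matrix.Norms.Frobenius Pointwise

namespace RankReg

/-! ## Generalized differentials in a Euclidean space -/

section Variational

variable {E F : Type*} [NormedAddCommGroup E] [InnerProductSpace ℝ E]
  [NormedAddCommGroup F] [InnerProductSpace ℝ F]

/-- The regular normal cone to `S` at `z`: `z ∈ S` and
`limsup ⟪v, z' - z⟫ / ‖z' - z‖ ≤ 0` as `z' → z` within `S`, written in its `ε`-form
`⟪v, z' - z⟫ ≤ o(‖z' - z‖)`. It is empty when `z ∉ S`. -/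
def regularNormalCone (S : Set E) (z : E) : Set E :=
  {v | z ∈ S ∧ ∀ ε : ℝ, 0 < ε →
    ∀ᶠ z' in nhdsWithin z S, inner ℝ v (z' - z) ≤ ε * ‖z' - z‖}

/-- The limiting normal cone to `S` at `z`: `z ∈ S`, and `v` is a limit of regular normals at
points of `S` converging to `z`. It is empty when `z ∉ S`. -/
def normalCone (S : Set E) (z : E) : Set E :=
  {v | z ∈ S ∧ ∃ (zs vs : ℕ → E), (∀ k, zs k ∈ S) ∧
    Filter.Tendsto zs Filter.atTop (nhds z) ∧ Filter.Tendsto vs Filter.atTop (nhds v) ∧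
    ∀ k, vs k ∈ regularNormalCone S (zs k)}

/-- The regular subdifferential of an extended real-valued `g` at `z`: `g z` is finite and
`liminf (g z' - g z - ⟪v, z' - z⟫) / ‖z' - z‖ ≥ 0` as `z' → z`, `z' ≠ z`, written in its
`ε`-form `g z' ≥ g z + ⟪v, z' - z⟫ - o(‖z' - z‖)`. It is empty when `g z` is infinite. -/
def regularSubdiff (g : E → EReal) (z : E) : Set E :=
  {v | g z ≠ ⊥ ∧ g z ≠ ⊤ ∧ ∀ ε : ℝ, 0 < ε →
    ∀ᶠ z' in nhds z, g z + ((inner ℝ v (z' - z) - ε * ‖z' - z‖ : ℝ) : EReal) ≤ g z'}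

/-- The limiting subdifferential of `g` at `z` (empty when `g z` is infinite): limits of regular
subgradients at points `zs k → z` with `g (zs k) → g z`. -/
def subdiff (g : E → EReal) (z : E) : Set E :=
  {v | g z ≠ ⊥ ∧ g z ≠ ⊤ ∧ ∃ (zs vs : ℕ → E),
    Filter.Tendsto zs Filter.atTop (nhds z) ∧
    Filter.Tendsto (fun k => g (zs k)) Filter.atTop (nhds (g z)) ∧
    Filter.Tendsto vs Filter.atTop (nhds v) ∧
    ∀ k, vs k ∈ regularSubdiff g (zs k)}

/-- The graph of a multifunction, in the product Euclidean space `E × F`. -/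
def gph (M : E → Set F) : Set (WithLp 2 (E × F)) :=
  {p | p.snd ∈ M p.fst}

/-- The coderivative of `M` at `z` for `w`:
`u ∈ D^*M(z|w)(v)` iff `(u, -v)` is a limiting normal to the graph of `M` at `(z, w)`. -/
def coderivative (M : E → Set F) (z : E) (w : F) (v : F) : Set E :=
  {u | WithLp.toLp 2 (u, -v) ∈ normalCone (gph M) (WithLp.toLp 2 (z, w))}

end Variational

/-! ## Matrices: trace inner product, singular values, nuclear norm -/

/-- The trace inner product `⟪A, B⟫ = tr (Aᵀ B)`; its norm is the Frobenius norm. -/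
noncomputable instance matrixInnerProductSpace {m n : ℕ} :
    InnerProductSpace ℝ (Matrix (Fin m) (Fin n) ℝ) where
  inner A B := (A.transpose * B).trace
  norm_sq_eq_re_inner A := by
    rw [Matrix.frobenius_norm_def, ← Real.sqrt_eq_rpow, Real.sq_sqrt (by positivity),
      Finset.sum_comm]
    simp [Matrix.trace, Matrix.mul_apply, pow_two]
  conj_inner_symm A B := by
    simp only [conj_trivial]
    rw [← Matrix.trace_transpose, Matrix.transpose_mul, Matrix.transpose_transpose]
  add_left A B C := by
    rw [Matrix.transpose_add, Matrix.add_mul, Matrix.trace_add]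
  smul_left A B r := by
    simp [Matrix.transpose_smul, Matrix.smul_mul, Matrix.trace_smul]

/-- The vector of the first `m` singular values of an `m × n` matrix, in nonincreasing order
(used for `m ≤ n`, where these are all its singular values `σ_1 ≥ ⋯ ≥ σ_m`). -/
noncomputable def sv {m n : ℕ} (X : Matrix (Fin m) (Fin n) ℝ) (i : Fin m) : ℝ :=
  (Matrix.toEuclideanLin X).singularValues i

/-- The nuclear norm (for `m ≤ n`): the sum of the singular values. -/
noncomputable def nuclearNorm {m n : ℕ} (X : Matrix (Fin m) (Fin n) ℝ) : ℝ :=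
  ∑ i, sv X i

/-- The subdifferential of the nuclear norm. -/
noncomputable def nuclearSubdiff {m n : ℕ} (X : Matrix (Fin m) (Fin n) ℝ) :
    Set (Matrix (Fin m) (Fin n) ℝ) :=
  subdiff (fun Y : Matrix (Fin m) (Fin n) ℝ => ((nuclearNorm Y : ℝ) : EReal)) X

/-- The `m × n` matrix `[Diag(x) 0]`. -/
def rectDiag {m : ℕ} (n : ℕ) (x : Fin m → ℝ) : Matrix (Fin m) (Fin n) ℝ :=
  Matrix.of fun i j => if (i : ℕ) = (j : ℕ) then x i else 0

/-- The set of pairs of orthogonal matrices `(U, V)` with `X = U [Diag(σ(X)) 0] Vᵀ`. -/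
def svdPairs {m n : ℕ} (X : Matrix (Fin m) (Fin n) ℝ) :
    Set (Matrix (Fin m) (Fin m) ℝ × Matrix (Fin n) (Fin n) ℝ) :=
  {p | p.1 ∈ Matrix.orthogonalGroup (Fin m) ℝ ∧ p.2 ∈ Matrix.orthogonalGroup (Fin n) ℝ ∧
    X = p.1 * rectDiag n (sv X) * p.2.transpose}

/-! ## Index sets and blocks -/

/-- Indices of the singular values greater than one. -/
def idxAlpha {m n : ℕ} (Z : Matrix (Fin m) (Fin n) ℝ) : Set (Fin m) := {i | 1 < sv Z i}

/-- Indices of the singular values equal to one. -/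
def idxBeta {m n : ℕ} (Z : Matrix (Fin m) (Fin n) ℝ) : Set (Fin m) := {i | sv Z i = 1}

/-- Indices of the singular values in `(0, 1)`. -/
def idxGamma1 {m n : ℕ} (Z : Matrix (Fin m) (Fin n) ℝ) : Set (Fin m) :=
  {i | 0 < sv Z i ∧ sv Z i < 1}

/-- Indices of the vanishing singular values. -/
def idxGamma0 {m n : ℕ} (Z : Matrix (Fin m) (Fin n) ℝ) : Set (Fin m) := {i | sv Z i = 0}

/-- `γ = γ₁ ∪ γ₀`. -/
def idxGamma {m n : ℕ} (Z : Matrix (Fin m) (Fin n) ℝ) : Set (Fin m) :=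
  idxGamma1 Z ∪ idxGamma0 Z

/-- The column indices `c = {m + 1, …, n}` (`m, …, n - 1` when counted from zero). -/
def idxC (m n : ℕ) : Set (Fin n) := {j | m ≤ (j : ℕ)}

/-- A set of indices in `{1, …, m}` seen as a set of column indices in `{1, …, n}`. -/
def asCols {m n : ℕ} (hmn : m ≤ n) (I : Set (Fin m)) : Set (Fin n) := Fin.castLE hmn '' I

/-- The submatrix `M_{IJ}`. -/
def block {m n : ℕ} (M : Matrix (Fin m) (Fin n) ℝ) (I : Set (Fin m)) (J : Set (Fin n)) :
    Matrix I J ℝ :=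
  M.submatrix Subtype.val Subtype.val

/-- The square submatrix `M_{II}`, for a set `I` of indices in `{1, …, m}`, `m ≤ n`. -/
def sqBlock {m n : ℕ} (hmn : m ≤ n) (M : Matrix (Fin m) (Fin n) ℝ) (I : Set (Fin m)) :
    Matrix I I ℝ :=
  M.submatrix Subtype.val fun i => Fin.castLE hmn i.val

/-- The symmetric part `(Y + Yᵀ) / 2` of a square matrix. -/
noncomputable def symPart {ι : Type*} (Y : Matrix ι ι ℝ) : Matrix ι ι ℝ :=
  (1 / 2 : ℝ) • (Y + Y.transpose)

/-! ## The families of functions `φ` -/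

/-- Proper lower semicontinuous convex functions `φ : ℝ → (-∞, +∞]` with
`[0, 1] ⊆ int (dom φ)`, `φ 1 = 1`, which have a minimizer `t* < 1` over `[0, 1]`
with `φ t* = 0`. -/
structure IsL (φ : ℝ → EReal) : Prop where
  ne_bot : ∀ t, φ t ≠ ⊥
  lsc : LowerSemicontinuous φ
  convex_epi : Convex ℝ {p : ℝ × ℝ | φ p.1 ≤ (p.2 : EReal)}
  dom : Set.Icc (0 : ℝ) 1 ⊆ interior {t | φ t < ⊤}
  one : φ 1 = 1
  argmin : ∃ t ∈ Set.Icc (0 : ℝ) 1, t < 1 ∧ IsMinOn φ (Set.Icc 0 1) t ∧ φ t = 0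

/-- The members of the family `IsL` that are differentiable on `(0, 1]`. (Every point of
`(0, 1]` is interior to the domain of `φ`, so `φ` is real-valued near it.) -/
structure IsL1 (φ : ℝ → EReal) : Prop extends IsL φ where
  differentiable : ∀ t ∈ Set.Ioc (0 : ℝ) 1, DifferentiableAt ℝ (fun s => (φ s).toReal) t

/-- `φ̂(t) = φ(|t|)`. -/
def phiHat (φ : ℝ → EReal) (t : ℝ) : EReal := φ |t|

/-- `Φ̂(x) = ∑ i, φ̂(x_i)`, composed with the singular value map. -/
noncomputable def phiHatSv {m n : ℕ} (φ : ℝ → EReal) (W : Matrix (Fin m) (Fin n) ℝ) : EReal :=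
  ∑ i, phiHat φ (sv W i)

/-! ## M-stationary points -/

/-- The set `ν ∂f(X) + N_Ω(X)`. -/
noncomputable def costSet {m n : ℕ} (ν : ℝ) (f : Matrix (Fin m) (Fin n) ℝ → ℝ)
    (Ω : Set (Matrix (Fin m) (Fin n) ℝ)) (X : Matrix (Fin m) (Fin n) ℝ) :
    Set (Matrix (Fin m) (Fin n) ℝ) :=
  ν • subdiff (fun Y : Matrix (Fin m) (Fin n) ℝ => ((f Y : ℝ) : EReal)) X + normalCone Ω X

/-- `X` is an M-stationary point, associated to `φ`, of the problem of minimizing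
`ν f(X) + rank(X)` over `X ∈ Ω`. -/
def IsMStationary {m n : ℕ} (ν : ℝ) (f : Matrix (Fin m) (Fin n) ℝ → ℝ)
    (Ω : Set (Matrix (Fin m) (Fin n) ℝ)) (φ : ℝ → EReal) (X : Matrix (Fin m) (Fin n) ℝ) : Prop :=
  ∃ W ∈ nuclearSubdiff X, ∃ DW ∈ subdiff (phiHatSv (m := m) (n := n) φ) W,
    (0 : Matrix (Fin m) (Fin n) ℝ) ∈ costSet ν f Ω X + coderivative nuclearSubdiff X W DW

end RankReg

namespace RankReg

/-! Stationarity supplies `G` in the cost set such that `(-G, -D)` is a limiting normal to the graph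
of the nuclear norm subdifferential at `(X, W)`, with `D` a limiting subgradient of the spectral
function at `W`; this `G` is ΔΓ. The graph has an algebraic description, `IsPolarPair`
(`mem_nuclearSubdiff_iff`): `W` is a contraction, `X Wᵀ` is symmetric positive semidefinite and `X
Wᵀ W = X`. Singular pairs of `X + W` of value `s` are shared by `X` and `W`, with values `max (s -
1) 0` and `min s 1`.

No formula for the normal cone is needed. A regular normal `(u, v)` is tested on explicit curves in
the graph: rotations on either side, rank-one changes of `X` with `W` fixed, shrinking `W` on the
kernel of `X`, and perturbing `W` where its singular values are below one. The resulting relations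
pass to limits. Orthogonal invariance makes `D Wᵀ` and `Wᵀ D` symmetric, so the rotation tests make
`u Xᵀ` and `Xᵀ u` symmetric; together with the rank-one test this gives `u Xᵀ = 0` and `Xᵀ u = 0`,
which are the rows and columns indexed by α.

For the β block, `D` has quadratic form `φ'(1) |y|²` on the right singular vectors of `W` of value
one (`IsL1.dotProduct_eq_of_mem_subdiff`), and `φ'(1) > 0`. This forces every such `y` to be a limit
of vectors in the ranges of the approximating `Xₖᵀ`, where the form of `u` vanishes
(`normal_dotProduct_eq_zero_of_neg`). For γ, the last test gives `(1 - W Wᵀ) D (1 - Wᵀ W) = 0`,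
while subgradients of the spectral function act as `φ'(s)` at a singular value `s` in `(0, 1)`, and
are bounded away from zero on the left kernel of `W` when `0 ∉ ∂φ̂(0)`. -/

/-! ### Singular values through characteristic polynomials, and commuting symmetric matrices. -/

open Matrix Polynomial in
/-- Adding a multiple of the projector on a unit eigenvector moves one eigenvalue. -/
theorem charpoly_add_smul_vecMulVec {m : ℕ} (H : Matrix (Fin m) (Fin m) ℝ) (u : Fin m → ℝ)
    (l c : ℝ) (hu : u ⬝ᵥ u = 1) (hH : H *ᵥ u = l • u) :
    (H + c • vecMulVec u u).charpoly * (X - C l) = H.charpoly * (X - C (l + c)) := by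
  refine Polynomial.eq_of_infinite_eval_eq _ _ ?_
  refine Set.Infinite.mono (s := {l}ᶜ) ?_ (Set.finite_singleton l).infinite_compl
  intro x hx
  have hx : x - l ≠ 0 := sub_ne_zero.2 hx
  -- Away from `x = l` the identity `(x - H) u = (x - l) u` lets `x - H` be factored out, leaving a
  -- rank-one update of the identity for the matrix determinant lemma.
  have key : scalar (Fin m) x - (H + c • vecMulVec u u) =
      (scalar (Fin m) x - H) * (1 + replicateCol Unit (-(c / (x - l)) • u) * replicateRow Unit u) := by
    have h1 : (scalar (Fin m) x - H) *ᵥ u = (x - l) • u := by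
      rw [sub_mulVec, hH, sub_smul, scalar_apply, ← smul_one_eq_diagonal, smul_mulVec, one_mulVec]
    rw [← vecMulVec_eq, mul_add, mul_one, mul_vecMulVec, mulVec_smul, h1, smul_smul, neg_mul,
      div_mul_cancel₀ _ hx, smul_vecMulVec, neg_smul]
    abel
  simp only [Set.mem_ofPred_eq, eval_mul, eval_charpoly, key, det_mul,
    det_one_add_replicateCol_mul_replicateRow, eval_sub, eval_X, eval_C, dotProduct_smul, hu]
  simp only [smul_eq_mul]
  field_simp
  ring

open Matrix Polynomial in
-- The squared singular values are by definition the eigenvalues of `Zᵀ Z`. Its characteristic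
-- polynomial differs from that of `Z Zᵀ` by a power of `X`, accounted for by the last `n - m`
-- singular values, which vanish because the rank is at most `m`.
theorem charpoly_mul_transpose_eq_prod_sv {m n : ℕ} (hmn : m ≤ n) (Z : Matrix (Fin m) (Fin n) ℝ) :
    (Z * Zᵀ).charpoly = ∏ i, (X - C (sv Z i ^ 2)) := by
  have h1 : (Zᵀ * Z).charpoly = ∏ i : Fin n, (X - C ((toEuclideanLin Z).singularValues i ^ 2)) := by
    have hn : Module.finrank ℝ (EuclideanSpace ℝ (Fin n)) = n := by simp
    have := (toEuclideanLin Z).isSymmetric_adjoint_comp_self.charpoly_eq hn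
    simp only [← LinearMap.sq_singularValues_fin] at this
    rw [← Matrix.toEuclideanLin_conjTranspose_eq_adjoint, conjTranspose_eq_transpose_of_trivial,
      ← Matrix.toLpLin_mul_same, Matrix.toLpLin_eq_toLin, charpoly_toLin] at this
    simpa using this
  have h2 := charpoly_mul_comm' Z Zᵀ
  obtain ⟨k, rfl⟩ := Nat.exists_eq_add_of_le hmn
  have h3 : ∀ i : Fin k, (toEuclideanLin Z).singularValues (Fin.natAdd m i : Fin (m + k)) = 0 := by
    intro i
    rw [LinearMap.singularValues_eq_zero_iff_le_finrank_range]
    refine (Submodule.finrank_le _).trans ?_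
    simp
  rw [h1, Fin.prod_univ_add] at h2
  simp only [h3, Fintype.card_fin, pow_add] at h2
  have h4 : (X ^ m * X ^ k : ℝ[X]) ≠ 0 := mul_ne_zero (pow_ne_zero _ X_ne_zero) (pow_ne_zero _ X_ne_zero)
  refine mul_left_cancel₀ h4 (h2.trans ?_)
  simp [sv]
  ring

theorem sv_nonneg {m n : ℕ} (Z : Matrix (Fin m) (Fin n) ℝ) (i : Fin m) : 0 ≤ sv Z i :=
  LinearMap.singularValues_nonneg _ _

open Matrix in
/-- A function of the squared singular values is summed over the roots of the characteristic
polynomial of `Z Zᵀ`. -/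
theorem sum_sv_eq_sum_roots {M : Type*} [AddCommMonoid M] {m n : ℕ} (hmn : m ≤ n)
    (Z : Matrix (Fin m) (Fin n) ℝ) (g : ℝ → M) :
    ∑ i, g (sv Z i) = ((Z * Zᵀ).charpoly.roots.map fun x => g √x).sum := by
  rw [charpoly_mul_transpose_eq_prod_sv hmn,
    Polynomial.roots_prod _ _ (Finset.prod_ne_zero_iff.2 fun i _ => Polynomial.X_sub_C_ne_zero _)]
  simp only [Polynomial.roots_X_sub_C, Multiset.bind_singleton, Multiset.map_map,
    Function.comp_def, Real.sqrt_sq (sv_nonneg Z _)]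
  rfl

open Matrix in
/-- Every singular value has a left singular vector. -/
theorem exists_left_singular_vector {m n : ℕ} (hmn : m ≤ n) (Z : Matrix (Fin m) (Fin n) ℝ)
    (i : Fin m) : ∃ a : Fin m → ℝ, a ≠ 0 ∧ Z *ᵥ (Zᵀ *ᵥ a) = sv Z i ^ 2 • a := by
  have h : (Z * Zᵀ).charpoly.IsRoot (sv Z i ^ 2) := by
    rw [charpoly_mul_transpose_eq_prod_sv hmn, Polynomial.IsRoot.def, Polynomial.eval_prod]
    exact Finset.prod_eq_zero (Finset.mem_univ i) (by simp)
  rw [Polynomial.IsRoot.def, eval_charpoly] at h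
  obtain ⟨a, ha, h⟩ := exists_mulVec_eq_zero_iff.2 h
  refine ⟨a, ha, ?_⟩
  rw [sub_mulVec, sub_eq_zero, scalar_apply, ← smul_one_eq_diagonal, smul_mulVec, one_mulVec] at h
  rw [mulVec_mulVec, h]

open Matrix in
/-- A symmetric matrix commuting with a symmetric matrix `A` is positive semidefinite when its
quadratic form is nonnegative on the eigenvectors of `A`. -/
theorem dotProduct_mulVec_nonneg_of_commute {m : ℕ} {A N : Matrix (Fin m) (Fin m) ℝ}
    (hA : Aᵀ = A) (hN : Nᵀ = N) (hc : A * N = N * A)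
    (h : ∀ (v : Fin m → ℝ) (l : ℝ), v ⬝ᵥ v = 1 → A *ᵥ v = l • v → 0 ≤ v ⬝ᵥ N *ᵥ v)
    (y : Fin m → ℝ) : 0 ≤ y ⬝ᵥ N *ᵥ y := by
  have hN' : N.IsHermitian := by rwa [IsHermitian, conjTranspose_eq_transpose_of_trivial]
  have hA' : A.IsHermitian := by rwa [IsHermitian, conjTranspose_eq_transpose_of_trivial]
  suffices hp : N.PosSemidef by simpa using hp.dotProduct_mulVec_nonneg y
  rw [hN'.posSemidef_iff_eigenvalues_nonneg]
  intro i
  by_contra! hi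
  simp only [Pi.zero_apply] at hi
  set μ := hN'.eigenvalues i
  -- Commutation makes the eigenspace of `N` for the negative eigenvalue invariant under `A`, so `A`
  -- has an eigenvector in it, where the form of `N` is negative.
  let S := Module.End.eigenspace (toEuclideanLin N) μ
  have hinv : ∀ x ∈ S, toEuclideanLin A x ∈ S := by
    intro x hx
    rw [Module.End.mem_eigenspace_iff] at hx ⊢
    rw [← LinearMap.map_smul, ← hx, ← LinearMap.comp_apply, ← LinearMap.comp_apply,
      ← toLpLin_mul_same, ← toLpLin_mul_same, hc]
  have hsym : (toEuclideanLin A).IsSymmetric := isSymmetric_toEuclideanLin_iff.2 hA'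
  have hnt : Nontrivial S := by
    rw [Submodule.nontrivial_iff_ne_bot]
    refine fun hS => ?_
    have : hN'.eigenvectorBasis i ∈ S := by
      rw [Module.End.mem_eigenspace_iff]
      ext j
      simpa using congrFun (hN'.mulVec_eigenvectorBasis i) j
    rw [hS, Submodule.mem_bot] at this
    exact hN'.eigenvectorBasis.toBasis.ne_zero i (by simpa using this)
  by_cases hev : ∀ l : ℝ, ¬ Module.End.HasEigenvalue ((toEuclideanLin A).restrict hinv) l
  · exact not_subsingleton S ((hsym.restrict_invariant hinv).subsingleton_of_no_eigenvalue_finiteDimensional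
      fun l => not_not.1 (hev l))
  push Not at hev
  obtain ⟨l, hl⟩ := hev
  obtain ⟨v, hv⟩ := hl.exists_hasEigenvector
  have hv1 := hv.apply_eq_smul
  have hv0 : (v : EuclideanSpace ℝ (Fin m)) ≠ 0 := by simpa using hv.2
  have hvA : toEuclideanLin A (v : EuclideanSpace ℝ (Fin m)) = l • (v : EuclideanSpace ℝ (Fin m)) := by
    have := congrArg Subtype.val hv1
    simpa using this
  have hvN := Module.End.mem_eigenspace_iff.1 v.2
  set w : Fin m → ℝ := WithLp.ofLp (v : EuclideanSpace ℝ (Fin m)) with hw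
  have hvA' : A *ᵥ w = l • w := by simpa using congrArg WithLp.ofLp hvA
  have hvN' : N *ᵥ w = μ • w := by simpa using congrArg WithLp.ofLp hvN
  have hw0 : w ≠ 0 := by simpa [hw] using hv0
  have hww : 0 < w ⬝ᵥ w := by simpa using dotProduct_star_self_pos_iff.2 hw0
  have := h ((√(w ⬝ᵥ w))⁻¹ • w) l (by
    rw [smul_dotProduct, dotProduct_smul, smul_smul, ← mul_inv, Real.mul_self_sqrt hww.le,
      smul_eq_mul, inv_mul_cancel₀ hww.ne']) (by rw [mulVec_smul, hvA', smul_comm])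
  rw [mulVec_smul, smul_dotProduct, dotProduct_smul, smul_smul, hvN', dotProduct_smul,
     ← mul_inv, Real.mul_self_sqrt hww.le, smul_eq_mul, smul_eq_mul, mul_comm μ, ← mul_assoc,
     inv_mul_cancel₀ hww.ne', one_mul] at this
  exact absurd this (not_le.2 hi)

/-! ### Testing regular normals and regular subgradients on curves and segments. -/

section Variational

variable {E : Type*} [NormedAddCommGroup E] [InnerProductSpace ℝ E]

theorem le_of_forall_pos_le_add_mul {a b c : ℝ} (h : ∀ ε : ℝ, 0 < ε → a ≤ b + ε * c) : a ≤ b := by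
  have h1 : Filter.Tendsto (fun ε : ℝ => b + ε * c) (nhdsWithin 0 (Set.Ioi 0)) (nhds b) := by
    have : Continuous fun ε : ℝ => b + ε * c := by fun_prop
    simpa using (this.tendsto 0).mono_left nhdsWithin_le_nhds
  exact ge_of_tendsto h1 (Filter.eventually_of_mem self_mem_nhdsWithin fun ε hε => h ε hε)

/-- A regular normal makes no acute angle with the velocity of a curve in the set. -/
theorem inner_le_zero_of_mem_regularNormalCone {S : Set E} {z v : E}
    (hv : v ∈ regularNormalCone S z) {γ : ℝ → E} {γ' : E} (h0 : γ 0 = z)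
    (hd : HasDerivAt γ γ' 0) (hS : ∀ᶠ t in nhdsWithin 0 (Set.Ioi 0), γ t ∈ S) :
    inner ℝ v γ' ≤ 0 := by
  refine le_of_forall_pos_le_add_mul (c := ‖γ'‖) fun ε hε => ?_
  rw [zero_add]
  have hγ : Filter.Tendsto γ (nhdsWithin 0 (Set.Ioi 0)) (nhdsWithin z S) :=
    tendsto_nhdsWithin_iff.2 ⟨by
      simpa [h0] using hd.continuousAt.tendsto.mono_left (nhdsWithin_le_nhds (s := Set.Ioi 0)), hS⟩
  have hs : Filter.Tendsto (fun t : ℝ => t⁻¹ • (γ t - z)) (nhdsWithin 0 (Set.Ioi 0)) (nhds γ') := by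
    have := hd.tendsto_slope_zero_right
    simpa [h0] using this
  refine le_of_tendsto_of_tendsto ((tendsto_const_nhds (x := v)).inner hs) (hs.norm.const_mul ε) ?_
  filter_upwards [hγ.eventually (hv.2 ε hε), self_mem_nhdsWithin] with t ht ht0
  have ht0 : 0 < t := ht0
  rw [inner_smul_right, norm_smul, Real.norm_of_nonneg (inv_nonneg.2 ht0.le), mul_left_comm]
  exact mul_le_mul_of_nonneg_left ht (inv_nonneg.2 ht0.le)

/-- Reduces testing a subgradient on curves of constant value to the test for normals. -/
theorem regularSubdiff_subset_regularNormalCone (g : E → EReal) (z : E) :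
    regularSubdiff g z ⊆ regularNormalCone {y | g y ≤ g z} z := by
  rintro v ⟨h1, h2, h3⟩
  refine ⟨le_refl (g z), fun ε hε => ?_⟩
  filter_upwards [nhdsWithin_le_nhds (h3 ε hε), self_mem_nhdsWithin] with y hy hyz
  lift g z to ℝ using ⟨h2, h1⟩ with a
  have := hy.trans hyz
  norm_cast at this
  linarith

/-- Convexity turns the local subgradient inequality into a global one. Only the start of the
segment matters, so the bound is required just for small `t`. -/
theorem le_of_mem_regularSubdiff {g : E → EReal} {z v y : E} {a b : ℝ}
    (hv : v ∈ regularSubdiff g z) (ha : g z = a)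
    (h : ∀ᶠ t : ℝ in nhdsWithin 0 (Set.Ioi 0), g (z + t • (y - z)) ≤ ((a + t * (b - a) : ℝ) : EReal)) :
    a + inner ℝ v (y - z) ≤ b := by
  refine le_of_forall_pos_le_add_mul (c := ‖y - z‖) fun ε hε => ?_
  have hγ : Filter.Tendsto (fun t : ℝ => z + t • (y - z)) (nhdsWithin 0 (Set.Ioi 0)) (nhds z) := by
    have : Continuous fun t : ℝ => z + t • (y - z) := by fun_prop
    simpa using (this.tendsto 0).mono_left nhdsWithin_le_nhds
  obtain ⟨t, ⟨h1, h2⟩, ht⟩ :=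
    (((hγ.eventually (hv.2.2 ε hε)).and h).and self_mem_nhdsWithin).exists
  have ht : 0 < t := ht
  have h3 := h1.trans h2
  rw [ha, add_sub_cancel_left, inner_smul_right, norm_smul, Real.norm_of_nonneg ht.le] at h3
  norm_cast at h3
  have : t * (inner ℝ v (y - z) - ε * ‖y - z‖) ≤ t * (b - a) := by linarith
  linarith [le_of_mul_le_mul_left this ht]

end Variational

/-! ### Duality between contractions and the nuclear norm. -/

open Matrix

theorem sq_dotProduct_le {n : ℕ} (x y : Fin n → ℝ) : (x ⬝ᵥ y) ^ 2 ≤ (x ⬝ᵥ x) * (y ⬝ᵥ y) := by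
  simpa [dotProduct, pow_two] using Finset.sum_mul_sq_le_sq_mul_sq Finset.univ x y

theorem dotProduct_self_nonneg' {n : ℕ} (x : Fin n → ℝ) : 0 ≤ x ⬝ᵥ x := by
  simpa using dotProduct_star_self_nonneg x

theorem dotProduct_mulVec_eq {m n : ℕ} (A : Matrix (Fin m) (Fin n) ℝ) (x : Fin m → ℝ)
    (y : Fin n → ℝ) : x ⬝ᵥ A *ᵥ y = (Aᵀ *ᵥ x) ⬝ᵥ y := by
  rw [dotProduct_mulVec, mulVec_transpose]

/-- The spectral norm of `C` is at most one. -/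
def IsContraction {m n : ℕ} (C : Matrix (Fin m) (Fin n) ℝ) : Prop :=
  ∀ x, (C *ᵥ x) ⬝ᵥ (C *ᵥ x) ≤ x ⬝ᵥ x

/-- By Cauchy–Schwarz, `|Cᵀx|⁴ = (x ⬝ C Cᵀ x)² ≤ |x|² |C Cᵀ x|² ≤ |x|² |Cᵀx|²`. -/
theorem IsContraction.transpose {m n : ℕ} {C : Matrix (Fin m) (Fin n) ℝ} (hC : IsContraction C) :
    IsContraction Cᵀ := by
  intro x
  set a := (Cᵀ *ᵥ x) ⬝ᵥ (Cᵀ *ᵥ x) with ha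
  have h1 : a = x ⬝ᵥ C *ᵥ (Cᵀ *ᵥ x) := by rw [dotProduct_mulVec_eq]
  have h2 := sq_dotProduct_le x (C *ᵥ (Cᵀ *ᵥ x))
  have h3 := hC (Cᵀ *ᵥ x)
  rw [← h1] at h2
  rw [← ha] at h3
  have h4 : 0 ≤ a := dotProduct_self_nonneg' _
  have h5 := dotProduct_self_nonneg' x
  by_contra! h6
  nlinarith

theorem IsContraction.mul {m n p : ℕ} {C : Matrix (Fin m) (Fin n) ℝ} {D : Matrix (Fin n) (Fin p) ℝ}
    (hC : IsContraction C) (hD : IsContraction D) : IsContraction (C * D) := fun x => by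
  rw [← mulVec_mulVec]
  exact (hC _).trans (hD x)

theorem isContraction_of_transpose_mul_self {m n : ℕ} {C : Matrix (Fin m) (Fin n) ℝ}
    (hC : Cᵀ * C = 1) : IsContraction C := fun x => by
  rw [dotProduct_mulVec_eq, mulVec_mulVec, hC, one_mulVec]

theorem transpose_mul_self_of_mem_orthogonalGroup {m : ℕ} {U : Matrix (Fin m) (Fin m) ℝ}
    (hU : U ∈ orthogonalGroup (Fin m) ℝ) : Uᵀ * U = 1 := by
  simpa [star_eq_conjTranspose] using (mem_orthogonalGroup_iff' (Fin m) ℝ).1 hU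

theorem self_mul_transpose_of_mem_orthogonalGroup {m : ℕ} {U : Matrix (Fin m) (Fin m) ℝ}
    (hU : U ∈ orthogonalGroup (Fin m) ℝ) : U * Uᵀ = 1 := by
  simpa [star_eq_conjTranspose] using (mem_orthogonalGroup_iff (Fin m) ℝ).1 hU

/-- An orthogonal eigenbasis of `Y Yᵀ`, and the nuclear norm in terms of it. -/
theorem exists_orthogonal_nuclearNorm_eq {m n : ℕ} (hmn : m ≤ n) (Y : Matrix (Fin m) (Fin n) ℝ) :
    ∃ (U : Matrix (Fin m) (Fin m) ℝ) (e : Fin m → ℝ), Uᵀ * U = 1 ∧ U * Uᵀ = 1 ∧ (∀ i, 0 ≤ e i) ∧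
      Uᵀ * (Y * Yᵀ) * U = diagonal (fun i => e i ^ 2) ∧ nuclearNorm Y = ∑ i, e i := by
  have hp : (Y * Yᵀ).PosSemidef := by
    simpa using posSemidef_self_mul_conjTranspose Y
  have hH := hp.isHermitian
  have hU := hH.eigenvectorUnitary.2
  have hev : ∀ i, 0 ≤ hH.eigenvalues i := fun i => hp.eigenvalues_nonneg i
  refine ⟨hH.eigenvectorUnitary, fun i => √(hH.eigenvalues i),
    transpose_mul_self_of_mem_orthogonalGroup hU, self_mul_transpose_of_mem_orthogonalGroup hU,
    fun i => Real.sqrt_nonneg _, ?_, ?_⟩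
  · have := hH.conjStarAlgAut_star_eigenvectorUnitary
    rw [Unitary.conjStarAlgAut_apply] at this
    simp only [Real.sq_sqrt (hev _)]
    simpa [star_eq_conjTranspose, Function.comp_def] using this
  · rw [nuclearNorm, sum_sv_eq_sum_roots hmn Y (fun x => x), hH.roots_charpoly_eq_eigenvalues]
    simp [List.sum_ofFn]

theorem transpose_mul_mul_apply_self {m : ℕ} (U M : Matrix (Fin m) (Fin m) ℝ) (i j : Fin m) :
    (Uᵀ * M * U) i j = U.col i ⬝ᵥ M *ᵥ U.col j := by
  rw [mul_assoc]
  rfl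

theorem trace_transpose_mul_eq_sum_col {m n : ℕ} {U : Matrix (Fin m) (Fin m) ℝ} (hU : U * Uᵀ = 1)
    (A B : Matrix (Fin m) (Fin n) ℝ) :
    (Aᵀ * B).trace = ∑ i, (Aᵀ *ᵥ U.col i) ⬝ᵥ (Bᵀ *ᵥ U.col i) := by
  have : (Aᵀ * B).trace = (Uᵀ * (A * Bᵀ) * U).trace := by
    rw [trace_mul_comm (Uᵀ * _), ← mul_assoc, hU, one_mul, ← trace_transpose, transpose_mul,
      transpose_transpose, trace_mul_comm]
  rw [this, trace]
  refine Finset.sum_congr rfl fun i _ => ?_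
  rw [← dotProduct_mulVec_eq, diag_apply, transpose_mul_mul_apply_self, mulVec_mulVec]

theorem ext_of_mulVec_col {m n : ℕ} {U : Matrix (Fin m) (Fin m) ℝ} (hU : U * Uᵀ = 1)
    {A B : Matrix (Fin n) (Fin m) ℝ} (h : ∀ i, A *ᵥ U.col i = B *ᵥ U.col i) : A = B := by
  have : A * U = B * U := by
    ext i j
    exact congrFun (h j) i
  rw [← Matrix.mul_one A, ← hU, ← Matrix.mul_assoc, this, Matrix.mul_assoc, hU, Matrix.mul_one]

theorem col_dotProduct_col {m : ℕ} {U : Matrix (Fin m) (Fin m) ℝ} (hU : Uᵀ * U = 1) (i : Fin m) :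
    U.col i ⬝ᵥ U.col i = 1 := by
  have := congrFun (congrFun hU i) i
  rwa [one_apply_eq, mul_apply] at this

/-- The data of `exists_orthogonal_nuclearNorm_eq` in terms of vectors. -/
theorem dotProduct_transpose_mulVec_col {m n : ℕ} {Y : Matrix (Fin m) (Fin n) ℝ}
    {U : Matrix (Fin m) (Fin m) ℝ} {e : Fin m → ℝ}
    (h : Uᵀ * (Y * Yᵀ) * U = diagonal (fun i => e i ^ 2)) (i : Fin m) :
    (Yᵀ *ᵥ U.col i) ⬝ᵥ (Yᵀ *ᵥ U.col i) = e i ^ 2 := by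
  rw [← dotProduct_mulVec_eq, mulVec_mulVec, ← transpose_mul_mul_apply_self, h, diagonal_apply_eq]

theorem IsContraction.dotProduct_le {m n : ℕ} {C : Matrix (Fin m) (Fin n) ℝ} (hC : IsContraction C)
    {x : Fin n → ℝ} {y : Fin m → ℝ} {e : ℝ} (he : 0 ≤ e) (hx : x ⬝ᵥ x ≤ 1) (hy : y ⬝ᵥ y = e ^ 2) :
    (C *ᵥ x) ⬝ᵥ y ≤ e := by
  refine abs_le_of_sq_le_sq' ?_ he |>.2
  have h1 := sq_dotProduct_le (C *ᵥ x) y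
  have h2 := hC x
  rw [hy] at h1
  nlinarith [sq_nonneg e]

theorem IsContraction.trace_le_nuclearNorm {m n : ℕ} (hmn : m ≤ n) {C : Matrix (Fin m) (Fin n) ℝ}
    (hC : IsContraction C) (Y : Matrix (Fin m) (Fin n) ℝ) : (Cᵀ * Y).trace ≤ nuclearNorm Y := by
  obtain ⟨U, e, hU, hU', he, hd, hn⟩ := exists_orthogonal_nuclearNorm_eq hmn Y
  rw [hn, trace_transpose_mul_eq_sum_col hU']
  exact Finset.sum_le_sum fun i _ => hC.transpose.dotProduct_le (he i) (col_dotProduct_col hU i).le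
    (dotProduct_transpose_mulVec_col hd i)

/-- The witness is the polar factor `(Y Yᵀ)^(-1/2) Y`; the convention `0⁻¹ = 0` makes the inverse
root a pseudo-inverse on the kernel. -/
theorem exists_contraction_trace_eq_nuclearNorm {m n : ℕ} (hmn : m ≤ n)
    (Y : Matrix (Fin m) (Fin n) ℝ) :
    ∃ C : Matrix (Fin m) (Fin n) ℝ, IsContraction C ∧ (Cᵀ * Y).trace = nuclearNorm Y := by
  obtain ⟨U, e, hU, hU', he, hd, hn⟩ := exists_orthogonal_nuclearNorm_eq hmn Y
  refine ⟨U * diagonal (fun i => (e i)⁻¹) * Uᵀ * Y, ?_, ?_⟩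
  · suffices h : IsContraction (U * diagonal (fun i => (e i)⁻¹) * Uᵀ * Y)ᵀ by
      simpa using h.transpose
    intro x
    rw [dotProduct_mulVec_eq, mulVec_mulVec, transpose_transpose]
    have h1 : U * diagonal (fun i => (e i)⁻¹) * Uᵀ * Y * (U * diagonal (fun i => (e i)⁻¹) * Uᵀ * Y)ᵀ =
        U * diagonal (fun i => (e i)⁻¹ * e i ^ 2 * (e i)⁻¹) * Uᵀ := by
      have : U * diagonal (fun i => (e i)⁻¹) * Uᵀ * Y * (U * diagonal (fun i => (e i)⁻¹) * Uᵀ * Y)ᵀ =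
        U * (diagonal (fun i => (e i)⁻¹) * (Uᵀ * (Y * Yᵀ) * U) * diagonal (fun i => (e i)⁻¹)) * Uᵀ := by
        simp only [transpose_mul, transpose_transpose, diagonal_transpose, Matrix.mul_assoc]
      rw [this, hd, diagonal_mul_diagonal, diagonal_mul_diagonal]
    have h2 : x ⬝ᵥ x = (Uᵀ *ᵥ x) ⬝ᵥ (Uᵀ *ᵥ x) := by
      rw [← dotProduct_mulVec_eq, mulVec_mulVec, hU', one_mulVec]
    rw [h1, mul_assoc, ← mulVec_mulVec, dotProduct_comm, dotProduct_mulVec_eq, ← mulVec_mulVec, h2]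
    simp only [dotProduct, mulVec_diagonal]
    refine Finset.sum_le_sum fun i _ => ?_
    rcases eq_or_ne (e i) 0 with h0 | h0
    · simp only [h0]
      simp [mul_self_nonneg]
    · have : (e i)⁻¹ * e i ^ 2 * (e i)⁻¹ = 1 := by field_simp
      rw [this, one_mul]
  · rw [hn, ← trace_transpose, transpose_mul, transpose_transpose, trace_mul_comm]
    have : (U * diagonal (fun i => (e i)⁻¹) * Uᵀ * Y * Yᵀ).trace =
        (diagonal (fun i => (e i)⁻¹) * (Uᵀ * (Y * Yᵀ) * U)).trace := by
      rw [Matrix.mul_assoc, Matrix.mul_assoc, Matrix.mul_assoc, trace_mul_comm U]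
      simp only [Matrix.mul_assoc]
    rw [this, hd, diagonal_mul_diagonal, trace_diagonal]
    refine Finset.sum_congr rfl fun i _ => ?_
    rcases eq_or_ne (e i) 0 with h0 | h0
    · simp [h0]
    · field_simp

/-! ### The graph of the nuclear norm subdifferential in algebraic form. -/

/-- `W` belongs to the subdifferential of the nuclear norm at `X`, in algebraic form. -/
structure IsPolarPair {m n : ℕ} (X W : Matrix (Fin m) (Fin n) ℝ) : Prop where
  contraction : IsContraction W
  symm : W * Xᵀ = X * Wᵀ
  nonneg : ∀ z, 0 ≤ z ⬝ᵥ (X * Wᵀ) *ᵥ z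
  mul_transpose_mul : X * Wᵀ * W = X

/-- In an eigenbasis of `X Xᵀ` the trace is a sum of terms each at most `eᵢ`, so equality of the
sums is equality in every Cauchy–Schwarz bound. Hence `Xᵀ uᵢ = eᵢ Wᵀ uᵢ` and `W Xᵀ uᵢ = eᵢ uᵢ`. -/
theorem isPolarPair_of_trace_eq {m n : ℕ} (hmn : m ≤ n) {X W : Matrix (Fin m) (Fin n) ℝ}
    (hW : IsContraction W) (h : (Wᵀ * X).trace = nuclearNorm X) : IsPolarPair X W := by
  obtain ⟨U, e, hU, hU', he, hd, hn⟩ := exists_orthogonal_nuclearNorm_eq hmn X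
  have hx := dotProduct_transpose_mulVec_col hd
  have hu := col_dotProduct_col hU
  rw [hn, trace_transpose_mul_eq_sum_col hU'] at h
  have h1 : ∀ i, (Wᵀ *ᵥ U.col i) ⬝ᵥ (Xᵀ *ᵥ U.col i) = e i := fun i =>
    (Finset.sum_eq_sum_iff_of_le fun i _ => hW.transpose.dotProduct_le (he i) (hu i).le (hx i)).1 h i
      (Finset.mem_univ i)
  have h2 : ∀ i, Xᵀ *ᵥ U.col i = e i • Wᵀ *ᵥ U.col i := by
    intro i
    rw [← sub_eq_zero, ← dotProduct_self_eq_zero]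
    refine le_antisymm ?_ (dotProduct_self_nonneg' _)
    have h3 := hW.transpose (U.col i)
    rw [hu] at h3
    simp only [sub_dotProduct, dotProduct_sub, smul_dotProduct, dotProduct_smul, h1, hx,
      dotProduct_comm (Xᵀ *ᵥ U.col i) (Wᵀ *ᵥ U.col i), smul_eq_mul]
    nlinarith [mul_nonneg (he i) (he i)]
  have h3 : ∀ i, W *ᵥ (Xᵀ *ᵥ U.col i) = e i • U.col i := by
    intro i
    rw [← sub_eq_zero, ← dotProduct_self_eq_zero]
    refine le_antisymm ?_ (dotProduct_self_nonneg' _)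
    have h3 := hW (Xᵀ *ᵥ U.col i)
    have h4 : (U.col i) ⬝ᵥ W *ᵥ (Xᵀ *ᵥ U.col i) = e i := by rw [dotProduct_mulVec_eq, h1]
    rw [hx] at h3
    simp only [sub_dotProduct, dotProduct_sub, smul_dotProduct, dotProduct_smul, h4, hu,
      dotProduct_comm (W *ᵥ (Xᵀ *ᵥ U.col i)) (U.col i), smul_eq_mul]
    nlinarith [mul_nonneg (he i) (he i)]
  have h4 : W * Xᵀ = U * diagonal e * Uᵀ := by
    refine ext_of_mulVec_col hU' fun i => ?_
    rw [← mulVec_mulVec, h3, ← mulVec_mulVec]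
    have : Uᵀ *ᵥ U.col i = Pi.single i 1 := by
      ext j
      exact (congrFun (congrFun hU j) i).trans (by simp [one_apply, Pi.single_apply])
    rw [this, ← mulVec_mulVec, diagonal_mulVec_single, mul_one, mulVec_single]
    ext; simp [mul_comm]
  have h5 : X * Wᵀ = W * Xᵀ := by
    rw [← transpose_transpose (X * Wᵀ), transpose_mul, transpose_transpose, h4]
    simp [mul_assoc]
  refine ⟨hW, h5.symm, fun z => ?_, ?_⟩
  · rw [h5, h4, mul_assoc, ← mulVec_mulVec, dotProduct_mulVec_eq, ← mulVec_mulVec]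
    simp only [dotProduct, mulVec_diagonal]
    exact Finset.sum_nonneg fun i _ => by nlinarith [he i, mul_self_nonneg ((Uᵀ *ᵥ z) i)]
  · rw [← transpose_transpose (X * Wᵀ * W), ← transpose_transpose X]
    congr 1
    refine ext_of_mulVec_col hU' fun i => ?_
    rw [transpose_mul, ← mulVec_mulVec, transpose_transpose, transpose_mul, transpose_transpose,
      ← mulVec_mulVec, h3, mulVec_smul, h2]

/-- For a contraction `C` attaining the norm of `X`, the identity `X = X Wᵀ W` turns `tr (Cᵀ X)`
into the trace of `X Wᵀ` times the contraction `W Cᵀ`. As `X Wᵀ` is positive semidefinite, this is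
at most `tr (X Wᵀ)`. -/
theorem IsPolarPair.trace_eq {m n : ℕ} (hmn : m ≤ n) {X W : Matrix (Fin m) (Fin n) ℝ}
    (h : IsPolarPair X W) : (Wᵀ * X).trace = nuclearNorm X := by
  refine le_antisymm (h.contraction.trace_le_nuclearNorm hmn X) ?_
  obtain ⟨C, hC, hCX⟩ := exists_contraction_trace_eq_nuclearNorm hmn X
  have hp : (X * Wᵀ).PosSemidef := .of_dotProduct_mulVec_nonneg (by
    rw [IsHermitian, conjTranspose_eq_transpose_of_trivial, transpose_mul, transpose_transpose,
      h.symm]) (by simpa using h.nonneg)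
  have hH := hp.isHermitian
  have hU := self_mul_transpose_of_mem_orthogonalGroup hH.eigenvectorUnitary.2
  have hU' := transpose_mul_self_of_mem_orthogonalGroup hH.eigenvectorUnitary.2
  have hev : ∀ i, (X * Wᵀ)ᵀ *ᵥ (hH.eigenvectorUnitary : Matrix (Fin m) (Fin m) ℝ).col i =
      hH.eigenvalues i • (hH.eigenvectorUnitary : Matrix (Fin m) (Fin m) ℝ).col i := by
    intro i
    rw [transpose_mul, transpose_transpose, h.symm]
    exact hH.mulVec_eigenvectorBasis i
  have h1 : nuclearNorm X = ((X * Wᵀ)ᵀ * (W * Cᵀ)).trace := by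
    rw [← hCX, transpose_mul, transpose_transpose, h.symm, ← Matrix.mul_assoc, h.mul_transpose_mul,
      trace_mul_comm]
  have h2 : (Wᵀ * X).trace = ((X * Wᵀ)ᵀ * 1).trace := by
    rw [Matrix.mul_one, trace_transpose, trace_mul_comm]
  rw [h1, h2, trace_transpose_mul_eq_sum_col hU, trace_transpose_mul_eq_sum_col hU]
  refine Finset.sum_le_sum fun i _ => ?_
  rw [hev, smul_dotProduct, smul_dotProduct, transpose_one, one_mulVec, col_dotProduct_col hU',
    dotProduct_comm]
  refine mul_le_mul_of_nonneg_left ?_ (hp.eigenvalues_nonneg i)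
  exact (h.contraction.mul hC.transpose).transpose.dotProduct_le zero_le_one
    (col_dotProduct_col hU' i).le (by rw [col_dotProduct_col hU', one_pow])

theorem inner_eq_trace {m n : ℕ} (A B : Matrix (Fin m) (Fin n) ℝ) :
    inner ℝ A B = (Aᵀ * B).trace := rfl

theorem inner_vecMulVec {m n : ℕ} (A : Matrix (Fin m) (Fin n) ℝ) (x : Fin m → ℝ) (y : Fin n → ℝ) :
    inner ℝ A (vecMulVec x y) = x ⬝ᵥ A *ᵥ y := by
  rw [inner_eq_trace, mul_vecMulVec, trace_vecMulVec, dotProduct_mulVec_eq]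

theorem nuclearNorm_add_le {m n : ℕ} (hmn : m ≤ n) (X Y : Matrix (Fin m) (Fin n) ℝ) :
    nuclearNorm (X + Y) ≤ nuclearNorm X + nuclearNorm Y := by
  obtain ⟨C, hC, h⟩ := exists_contraction_trace_eq_nuclearNorm hmn (X + Y)
  rw [← h, Matrix.mul_add, trace_add]
  exact add_le_add (hC.trace_le_nuclearNorm hmn X) (hC.trace_le_nuclearNorm hmn Y)

theorem nuclearNorm_smul_le {m n : ℕ} (hmn : m ≤ n) {t : ℝ} (ht : 0 ≤ t)
    (X : Matrix (Fin m) (Fin n) ℝ) : nuclearNorm (t • X) ≤ t * nuclearNorm X := by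
  obtain ⟨C, hC, h⟩ := exists_contraction_trace_eq_nuclearNorm hmn (t • X)
  rw [← h, Matrix.mul_smul, trace_smul]
  exact mul_le_mul_of_nonneg_left (hC.trace_le_nuclearNorm hmn X) ht

theorem le_nuclearNorm_of_mem_nuclearSubdiff {m n : ℕ} (hmn : m ≤ n)
    {X W : Matrix (Fin m) (Fin n) ℝ} (h : W ∈ nuclearSubdiff X) (Y : Matrix (Fin m) (Fin n) ℝ) :
    nuclearNorm X + inner ℝ W (Y - X) ≤ nuclearNorm Y := by
  obtain ⟨-, -, zs, vs, hz, hg, hv, hr⟩ := h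
  have h1 : ∀ k, nuclearNorm (zs k) + inner ℝ (vs k) (Y - zs k) ≤ nuclearNorm Y := by
    intro k
    refine le_of_mem_regularSubdiff (hr k) rfl ?_
    filter_upwards [Ioo_mem_nhdsGT (zero_lt_one' ℝ)] with t ht
    norm_cast
    have h2 : zs k + t • (Y - zs k) = (1 - t) • zs k + t • Y := by
      rw [smul_sub, sub_smul, one_smul]; abel
    rw [h2]
    have := (nuclearNorm_add_le hmn ((1 - t) • zs k) (t • Y)).trans (add_le_add
      (nuclearNorm_smul_le hmn (sub_nonneg.2 ht.2.le) _) (nuclearNorm_smul_le hmn ht.1.le _))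
    linarith
  rw [EReal.tendsto_coe] at hg
  exact le_of_tendsto (hg.add (hv.inner (hz.const_sub Y))) (Filter.Eventually.of_forall h1)

theorem mem_nuclearSubdiff_iff {m n : ℕ} (hmn : m ≤ n) {X W : Matrix (Fin m) (Fin n) ℝ} :
    W ∈ nuclearSubdiff X ↔ IsPolarPair X W := by
  constructor
  · intro h
    have hle := le_nuclearNorm_of_mem_nuclearSubdiff hmn h
    have h1 : ∀ Y, inner ℝ W Y ≤ nuclearNorm Y := fun Y => by
      have := hle (X + Y)
      rw [add_sub_cancel_left] at this
      linarith [nuclearNorm_add_le hmn X Y]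
    refine isPolarPair_of_trace_eq hmn ?_ ?_
    · intro q
      -- The rank-one matrix `(W q) qᵀ` has nuclear norm at most `|W q| |q|`, while its inner
      -- product with `W` is `|W q|²`.
      have h2 := h1 (vecMulVec (W *ᵥ q) q)
      obtain ⟨C, hC, hC'⟩ := exists_contraction_trace_eq_nuclearNorm hmn (vecMulVec (W *ᵥ q) q)
      rw [← hC', ← inner_eq_trace, inner_vecMulVec, inner_vecMulVec] at h2
      have h3 := sq_dotProduct_le (W *ᵥ q) (C *ᵥ q)
      have h4 := hC q
      have h5 := dotProduct_self_nonneg' (W *ᵥ q)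
      have h6 := dotProduct_self_nonneg' q
      by_contra! h7
      nlinarith
    · refine le_antisymm (h1 X) ?_
      have h2 := hle ((0 : ℝ) • X)
      have h3 := nuclearNorm_smul_le hmn le_rfl X
      rw [zero_smul, zero_sub, inner_neg_right] at h2
      rw [zero_smul, zero_mul] at h3
      rw [← inner_eq_trace]
      linarith
  · intro h
    have hreg : W ∈ regularSubdiff
        (fun Y : Matrix (Fin m) (Fin n) ℝ => ((nuclearNorm Y : ℝ) : EReal)) X := by
      refine ⟨EReal.coe_ne_bot _, EReal.coe_ne_top _, fun ε hε => Filter.Eventually.of_forall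
        fun Y => ?_⟩
      have h1 := h.contraction.trace_le_nuclearNorm hmn Y
      have h2 := h.trace_eq hmn
      rw [← inner_eq_trace] at h1 h2
      rw [inner_sub_right]
      have h3 := mul_nonneg hε.le (norm_nonneg (Y - X))
      dsimp only
      rw [← EReal.coe_add, EReal.coe_le_coe_iff]
      linarith
    exact ⟨EReal.coe_ne_bot _, EReal.coe_ne_top _, fun _ => X, fun _ => W, tendsto_const_nhds,
      tendsto_const_nhds, tendsto_const_nhds, fun _ => hreg⟩

theorem IsPolarPair.transpose {m n : ℕ} {X W : Matrix (Fin m) (Fin n) ℝ} (h : IsPolarPair X W) :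
    IsPolarPair Xᵀ Wᵀ := by
  have h1 : W * Xᵀ * W = X := by rw [h.symm, h.mul_transpose_mul]
  have h2 : Wᵀ * X * Wᵀ = Xᵀ := by
    conv_rhs => rw [← h1]
    simp [Matrix.mul_assoc]
  have h3 : Wᵀ * X = Wᵀ * (X * Wᵀ) * W := by rw [Matrix.mul_assoc, h.mul_transpose_mul]
  have h4 : Xᵀ * W = Wᵀ * (X * Wᵀ) * W := by
    rw [← h.symm, ← transpose_transpose (Xᵀ * W), transpose_mul, transpose_transpose, h3]
    simp [Matrix.mul_assoc]
  refine ⟨h.contraction.transpose, ?_, fun z => ?_, ?_⟩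
  · rw [transpose_transpose, transpose_transpose, h3, h4]
  · rw [transpose_transpose, h4, Matrix.mul_assoc, ← mulVec_mulVec, dotProduct_mulVec_eq,
      transpose_transpose, ← mulVec_mulVec]
    exact h.nonneg _
  · rw [transpose_transpose, h4, ← h3, h2]

/-- The nuclear and spectral components of a sum inherit its singular pairs. -/
theorem IsPolarPair.transpose_mulVec_of_singular {m n : ℕ} {X W : Matrix (Fin m) (Fin n) ℝ}
    (h : IsPolarPair X W) {a : Fin m → ℝ} {b : Fin n → ℝ} {s : ℝ} (hs : 0 ≤ s)
    (h1 : (X + W) *ᵥ b = s • a) (h2 : (X + W)ᵀ *ᵥ a = s • b) :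
    Xᵀ *ᵥ a = max (s - 1) 0 • b ∧ Wᵀ *ᵥ a = min s 1 • b := by
  obtain ⟨R, hR⟩ : ∃ R, R = X * Wᵀ := ⟨_, rfl⟩
  have hRt : Rᵀ = R := by rw [hR, transpose_mul, transpose_transpose, h.symm]
  have hX : X = R * W := by rw [hR, h.mul_transpose_mul]
  have hXt : Xᵀ = Wᵀ * R := by rw [hX, transpose_mul, hRt]
  have hK : R * (W * Wᵀ) = R := by rw [← Matrix.mul_assoc, ← hX, hR]
  have hK' : W * Wᵀ * R = R := by rw [Matrix.mul_assoc, ← hXt, h.symm, hR]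
  have hpos : ∀ z, 0 ≤ z ⬝ᵥ R *ᵥ z := by rw [hR]; exact h.nonneg
  obtain ⟨r, hr⟩ : ∃ r, r = R *ᵥ a := ⟨_, rfl⟩
  have hZ : (X + W) * (X + W)ᵀ = R * R + (2 : ℝ) • R + W * Wᵀ := by
    rw [transpose_add, Matrix.add_mul, Matrix.mul_add, Matrix.mul_add, hXt, ← hXt, h.symm, ← hR,
      hXt]
    conv_lhs => rw [hX]
    rw [Matrix.mul_assoc, ← Matrix.mul_assoc W, hK', two_smul]
    abel
  -- With `R = X Wᵀ` one has `Z Zᵀ = R² + 2R + W Wᵀ`. Applying `R` gives `(R + 1)² r = s² r` for `r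
  -- = R a`, and positivity of `R` selects the root `R r = (s - 1) r`.
  have e1 : R *ᵥ r + (2 : ℝ) • r + (W * Wᵀ) *ᵥ a = s ^ 2 • a := by
    have : ((X + W) * (X + W)ᵀ) *ᵥ a = s ^ 2 • a := by
      rw [← mulVec_mulVec, h2, mulVec_smul, h1, smul_smul, pow_two]
    rw [← this, hZ, add_mulVec, add_mulVec, smul_mulVec, hr, mulVec_mulVec a R R]
  have e2 : R *ᵥ R *ᵥ r + (2 : ℝ) • R *ᵥ r + r = s ^ 2 • r := by
    have := congrArg (R *ᵥ ·) e1
    simp only [mulVec_add, mulVec_smul] at this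
    rwa [mulVec_mulVec a R (W * Wᵀ), hK, ← hr] at this
  have e3 : R *ᵥ r = (s - 1) • r := by
    obtain ⟨q, hq⟩ : ∃ q, q = R *ᵥ r - (s - 1) • r := ⟨_, rfl⟩
    have hRq : R *ᵥ q = -(s + 1) • q := by
      rw [hq, mulVec_sub, mulVec_smul]
      have := eq_sub_of_add_eq (eq_sub_of_add_eq e2)
      rw [this]
      module
    have := hpos q
    rw [hRq, dotProduct_smul, smul_eq_mul] at this
    have hq0 : q = 0 := by
      rw [← dotProduct_self_eq_zero]
      nlinarith [dotProduct_self_nonneg' q]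
    rwa [hq, sub_eq_zero] at hq0
  -- For `s ≤ 1`, `|r|² = (s - 1) (a ⬝ r) ≤ 0`. For `s > 1` the defect `(s - 1) a - r` would be an
  -- eigenvector of `W Wᵀ` for `s² > 1`, impossible for a contraction; `s = 1` is handled apart.
  have e4 : r = max (s - 1) 0 • a := by
    rcases le_total s 1 with hs1 | hs1
    · rw [max_eq_right (by linarith), zero_smul, ← dotProduct_self_eq_zero]
      refine le_antisymm ?_ (dotProduct_self_nonneg' _)
      have e5 : r ⬝ᵥ r = (s - 1) * (a ⬝ᵥ r) := by
        rw [← smul_eq_mul, ← dotProduct_smul, ← e3, dotProduct_mulVec_eq, hRt, ← hr]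
      have := hpos a
      rw [← hr] at this
      nlinarith
    · rw [max_eq_left (by linarith)]
      rcases eq_or_lt_of_le hs1 with rfl | hs1
      · rw [sub_self, zero_smul] at e3 ⊢
        rw [← dotProduct_self_eq_zero]
        conv_lhs => rw [hr]
        rw [dotProduct_comm, dotProduct_mulVec_eq, hRt, ← hr, e3, zero_dotProduct]
      obtain ⟨p, hp⟩ : ∃ p, p = (s - 1) • a - r := ⟨_, rfl⟩
      have e5 : (W * Wᵀ) *ᵥ r = r := by rw [hr, mulVec_mulVec, hK']
      have e6 : (W * Wᵀ) *ᵥ p = s ^ 2 • p := by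
        rw [hp, mulVec_sub, mulVec_smul, e5]
        rw [e3] at e1
        rw [eq_sub_of_add_eq' e1]
        module
      have e7 := h.contraction.transpose p
      rw [← dotProduct_mulVec_eq, mulVec_mulVec, e6, dotProduct_smul, smul_eq_mul] at e7
      have : p = 0 := by
        rw [← dotProduct_self_eq_zero]
        have : 1 < s ^ 2 := one_lt_pow₀ hs1 two_ne_zero
        nlinarith [dotProduct_self_nonneg' p]
      rw [hp, sub_eq_zero] at this
      exact this.symm
  have e5 : Xᵀ *ᵥ a = max (s - 1) 0 • Wᵀ *ᵥ a := by
    rw [hXt, ← mulVec_mulVec, ← hr, e4, mulVec_smul]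
  rw [transpose_add, add_mulVec, e5] at h2
  rw [e5]
  rcases le_total s 1 with hs1 | hs1
  · rw [max_eq_right (by linarith), zero_smul, zero_add] at h2
    rw [max_eq_right (by linarith), min_eq_left hs1, h2]
    simp
  · rw [max_eq_left (by linarith)] at h2
    have : Wᵀ *ᵥ a = b := by
      have h3 : s • Wᵀ *ᵥ a = s • b := by rw [← h2]; module
      exact smul_right_injective _ (by linarith : s ≠ 0) h3
    rw [this, min_eq_right hs1, one_smul]
    exact ⟨rfl, rfl⟩

theorem IsPolarPair.mulVec_of_singular {m n : ℕ} {X W : Matrix (Fin m) (Fin n) ℝ}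
    (h : IsPolarPair X W) {a : Fin m → ℝ} {b : Fin n → ℝ} {s : ℝ} (hs : 0 ≤ s)
    (h1 : (X + W) *ᵥ b = s • a) (h2 : (X + W)ᵀ *ᵥ a = s • b) :
    X *ᵥ b = max (s - 1) 0 • a ∧ W *ᵥ b = min s 1 • a := by
  have := h.transpose.transpose_mulVec_of_singular (a := b) (b := a) hs
    (by rw [← transpose_add, h2]) (by rw [← transpose_add, transpose_transpose, h1])
  simpa using this

theorem norm_vecMulVec {m n : ℕ} (x : Fin m → ℝ) (y : Fin n → ℝ) :
    ‖vecMulVec x y‖ ^ 2 = (x ⬝ᵥ x) * (y ⬝ᵥ y) := by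
  rw [← real_inner_self_eq_norm_sq, inner_vecMulVec, vecMulVec_mulVec]
  simp [mul_comm]

theorem dotProduct_mulVec_le {m : ℕ} (P : Matrix (Fin m) (Fin m) ℝ) (y : Fin m → ℝ) :
    y ⬝ᵥ P *ᵥ y ≤ ‖P‖ * (y ⬝ᵥ y) := by
  have h : ‖vecMulVec y y‖ = y ⬝ᵥ y := by
    rw [← sq_eq_sq₀ (norm_nonneg _) (dotProduct_self_nonneg' y), norm_vecMulVec, pow_two]
  rw [← inner_vecMulVec, ← h]
  exact real_inner_le_norm _ _

/-! ### Tests of regular normals to the graph -/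

section Velocity

variable {E F : Type*} [NormedAddCommGroup E] [InnerProductSpace ℝ E]
  [NormedAddCommGroup F] [InnerProductSpace ℝ F]

/-- The curve `γ` has velocity `γ'` at time zero. -/
def HasVelocity (γ : ℝ → E) (γ' : E) : Prop := HasDerivAt γ γ' 0

theorem HasVelocity.prodMk {γ : ℝ → E} {γ' : E} {δ : ℝ → F} {δ' : F} (hγ : HasVelocity γ γ')
    (hδ : HasVelocity δ δ') :
    HasVelocity (fun t => WithLp.toLp 2 (γ t, δ t)) (WithLp.toLp 2 (γ', δ')) :=
  ((WithLp.prodContinuousLinearEquiv 2 ℝ E F).symm.hasFDerivAt).comp_hasDerivAt 0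
    (HasDerivAt.prodMk hγ hδ)

theorem HasVelocity.map [FiniteDimensional ℝ E] {γ : ℝ → E} {γ' : E} (hγ : HasVelocity γ γ')
    (L : E →ₗ[ℝ] F) : HasVelocity (fun t => L (γ t)) (L γ') :=
  L.toContinuousLinearMap.hasFDerivAt.comp_hasDerivAt 0 hγ

theorem hasVelocity_add_smul (x d : E) : HasVelocity (fun t : ℝ => x + t • d) d := by
  have := ((hasDerivAt_id (0 : ℝ)).smul_const d).const_add x
  simpa [HasVelocity] using this

theorem hasVelocity_const (x : E) : HasVelocity (fun _ : ℝ => x) 0 :=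
  hasDerivAt_const 0 x

end Velocity

/-- Everything known about regular normals to the graph comes from this inequality, applied to
suitable curves of polar pairs. -/
theorem inner_add_inner_le_zero {m n : ℕ} (hmn : m ≤ n) {u v X W : Matrix (Fin m) (Fin n) ℝ}
    (hN : WithLp.toLp 2 (u, v) ∈ regularNormalCone (gph nuclearSubdiff) (WithLp.toLp 2 (X, W)))
    {γ δ : ℝ → Matrix (Fin m) (Fin n) ℝ} {γ' δ' : Matrix (Fin m) (Fin n) ℝ}
    (hγ0 : γ 0 = X) (hδ0 : δ 0 = W) (hγ : HasVelocity γ γ') (hδ : HasVelocity δ δ')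
    (h : ∀ᶠ t in nhdsWithin 0 (Set.Ioi 0), IsPolarPair (γ t) (δ t)) :
    inner ℝ u γ' + inner ℝ v δ' ≤ 0 :=
  inner_le_zero_of_mem_regularNormalCone hN (γ := fun t => WithLp.toLp 2 (γ t, δ t))
    (by simp [hγ0, hδ0]) (hγ.prodMk hδ) (h.mono fun t ht => (mem_nuclearSubdiff_iff hmn).2 ht)

theorem hasVelocity_exp_smul {m : ℕ} (A : Matrix (Fin m) (Fin m) ℝ) :
    HasVelocity (fun t : ℝ => NormedSpace.exp (t • A)) A := by
  have := hasDerivAt_exp_smul_const A (0 : ℝ)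
  rw [zero_smul, NormedSpace.exp_zero, one_mul] at this
  exact this

theorem exp_smul_transpose_mul_self {m : ℕ} {A : Matrix (Fin m) (Fin m) ℝ} (hA : Aᵀ = -A) (t : ℝ) :
    (NormedSpace.exp (t • A))ᵀ * NormedSpace.exp (t • A) = 1 := by
  rw [← exp_transpose, transpose_smul, hA, smul_neg, exp_neg]
  exact nonsing_inv_mul _ ((isUnit_iff_isUnit_det _).1 (isUnit_exp _))

theorem exp_smul_mul_transpose {m : ℕ} {A : Matrix (Fin m) (Fin m) ℝ} (hA : Aᵀ = -A) (t : ℝ) :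
    NormedSpace.exp (t • A) * (NormedSpace.exp (t • A))ᵀ = 1 :=
  mul_eq_one_comm.1 (exp_smul_transpose_mul_self hA t)

theorem hasVelocity_exp_smul_mul {m n : ℕ} (A : Matrix (Fin m) (Fin m) ℝ)
    (X : Matrix (Fin m) (Fin n) ℝ) :
    HasVelocity (fun t : ℝ => NormedSpace.exp (t • A) * X) (A * X) :=
  (hasVelocity_exp_smul A).map (mulRightLinearMap (Fin m) ℝ X)

theorem hasVelocity_mul_exp_smul {m n : ℕ} (A : Matrix (Fin n) (Fin n) ℝ)
    (X : Matrix (Fin m) (Fin n) ℝ) :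
    HasVelocity (fun t : ℝ => X * NormedSpace.exp (t • A)) (X * A) :=
  (hasVelocity_exp_smul A).map (mulLeftLinearMap (Fin n) ℝ X)

theorem IsPolarPair.orthogonal_mul {m n : ℕ} {X W : Matrix (Fin m) (Fin n) ℝ} (h : IsPolarPair X W)
    {U : Matrix (Fin m) (Fin m) ℝ} (hU : Uᵀ * U = 1) : IsPolarPair (U * X) (U * W) := by
  refine ⟨(isContraction_of_transpose_mul_self hU).mul h.contraction, ?_, fun z => ?_, ?_⟩
  · simp only [transpose_mul, Matrix.mul_assoc]
    rw [← Matrix.mul_assoc W, h.symm, Matrix.mul_assoc]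
  · have := h.nonneg (Uᵀ *ᵥ z)
    rw [← dotProduct_mulVec_eq, mulVec_mulVec, mulVec_mulVec] at this
    simpa only [transpose_mul, Matrix.mul_assoc] using this
  · rw [transpose_mul, Matrix.mul_assoc, Matrix.mul_assoc Wᵀ, ← Matrix.mul_assoc Uᵀ, hU,
      Matrix.one_mul, Matrix.mul_assoc, ← Matrix.mul_assoc X, h.mul_transpose_mul]

theorem IsPolarPair.mul_orthogonal {m n : ℕ} {X W : Matrix (Fin m) (Fin n) ℝ} (h : IsPolarPair X W)
    {V : Matrix (Fin n) (Fin n) ℝ} (hV : V * Vᵀ = 1) : IsPolarPair (X * V) (W * V) := by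
  have := (h.transpose.orthogonal_mul (U := Vᵀ) (by rw [transpose_transpose, hV])).transpose
  simpa using this

/-- The skew matrix `M - Mᵀ` is itself admissible as a test, and its inner product with `M` is half
its squared norm. -/
theorem eq_transpose_of_inner_le_zero {m : ℕ} {M : Matrix (Fin m) (Fin m) ℝ}
    (h : ∀ A : Matrix (Fin m) (Fin m) ℝ, Aᵀ = -A → inner ℝ M A ≤ 0) : Mᵀ = M := by
  have h1 := h (M - Mᵀ) (by simp)
  have h2 : inner ℝ Mᵀ (M - Mᵀ) = - inner ℝ M (M - Mᵀ) := by
    rw [inner_eq_trace, inner_eq_trace, ← trace_transpose, transpose_mul, transpose_transpose,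
      trace_mul_comm, ← trace_neg, ← Matrix.mul_neg, transpose_sub, transpose_transpose, neg_sub]
  have h3 : inner ℝ (M - Mᵀ) (M - Mᵀ) ≤ 0 := by
    conv_lhs => rw [inner_sub_left, h2]
    linarith
  rw [real_inner_self_nonpos, sub_eq_zero] at h3
  exact h3.symm

theorem inner_mul_left_eq {m n : ℕ} (u X : Matrix (Fin m) (Fin n) ℝ) (A : Matrix (Fin m) (Fin m) ℝ) :
    inner ℝ u (A * X) = inner ℝ (u * Xᵀ) A := by
  rw [inner_eq_trace, inner_eq_trace, transpose_mul, transpose_transpose, ← Matrix.mul_assoc,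
    trace_mul_comm, Matrix.mul_assoc]

theorem inner_mul_right_eq {m n : ℕ} (u X : Matrix (Fin m) (Fin n) ℝ) (A : Matrix (Fin n) (Fin n) ℝ) :
    inner ℝ u (X * A) = inner ℝ (Xᵀ * u) A := by
  rw [inner_eq_trace, inner_eq_trace, transpose_mul, transpose_transpose, ← Matrix.mul_assoc]

/-- Rotations `exp(tA)` with `A` skew preserve the graph, and their velocity at `(X, W)` is `(A X, A
W)`. -/
theorem regularNormal_left_symm {m n : ℕ} (hmn : m ≤ n) {u v X W : Matrix (Fin m) (Fin n) ℝ}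
    (hP : IsPolarPair X W)
    (hN : WithLp.toLp 2 (u, v) ∈ regularNormalCone (gph nuclearSubdiff) (WithLp.toLp 2 (X, W))) :
    (u * Xᵀ + v * Wᵀ)ᵀ = u * Xᵀ + v * Wᵀ := by
  refine eq_transpose_of_inner_le_zero fun A hA => ?_
  rw [inner_add_left, ← inner_mul_left_eq, ← inner_mul_left_eq]
  exact inner_add_inner_le_zero hmn hN (by simp) (by simp) (hasVelocity_exp_smul_mul A X)
    (hasVelocity_exp_smul_mul A W) (Filter.Eventually.of_forall fun t =>
      hP.orthogonal_mul (exp_smul_transpose_mul_self hA t))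

theorem regularNormal_right_symm {m n : ℕ} (hmn : m ≤ n) {u v X W : Matrix (Fin m) (Fin n) ℝ}
    (hP : IsPolarPair X W)
    (hN : WithLp.toLp 2 (u, v) ∈ regularNormalCone (gph nuclearSubdiff) (WithLp.toLp 2 (X, W))) :
    (Xᵀ * u + Wᵀ * v)ᵀ = Xᵀ * u + Wᵀ * v := by
  refine eq_transpose_of_inner_le_zero fun A hA => ?_
  rw [inner_add_left, ← inner_mul_right_eq, ← inner_mul_right_eq]
  exact inner_add_inner_le_zero hmn hN (by simp) (by simp) (hasVelocity_mul_exp_smul A X)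
    (hasVelocity_mul_exp_smul A W) (Filter.Eventually.of_forall fun t =>
      hP.mul_orthogonal (exp_smul_mul_transpose hA t))

theorem sq_dotProduct_mulVec_le {m : ℕ} {R : Matrix (Fin m) (Fin m) ℝ} (hRt : Rᵀ = R)
    (hR : ∀ z, 0 ≤ z ⬝ᵥ R *ᵥ z) (p z : Fin m → ℝ) :
    (p ⬝ᵥ R *ᵥ z) ^ 2 ≤ (p ⬝ᵥ R *ᵥ p) * (z ⬝ᵥ R *ᵥ z) := by
  have h := discrim_le_zero (a := z ⬝ᵥ R *ᵥ z) (b := 2 * p ⬝ᵥ R *ᵥ z) (c := p ⬝ᵥ R *ᵥ p) fun t => by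
    have := hR (p + t • z)
    have h1 : z ⬝ᵥ R *ᵥ p = p ⬝ᵥ R *ᵥ z := by
      rw [dotProduct_mulVec_eq, hRt, dotProduct_comm]
    simp only [mulVec_add, mulVec_smul, dotProduct_add, add_dotProduct, smul_dotProduct,
      dotProduct_smul, smul_eq_mul, h1] at this
    linarith
  rw [discrim] at h
  linarith

theorem vecMulVec_mulVec' {m n : ℕ} (x : Fin m → ℝ) (y z : Fin n → ℝ) :
    vecMulVec x y *ᵥ z = (y ⬝ᵥ z) • x := by
  rw [vecMulVec_mulVec]
  ext
  simp [mul_comm]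

/-- Moving `X` within the normal cone of the spectral ball at `W`. -/
theorem IsPolarPair.add_smul_vecMulVec {m n : ℕ} {X W : Matrix (Fin m) (Fin n) ℝ}
    (h : IsPolarPair X W) (z : Fin m → ℝ) {t : ℝ} (ht : 0 ≤ 1 + t * (z ⬝ᵥ (X * Wᵀ) *ᵥ z)) :
    IsPolarPair (X + t • vecMulVec (W *ᵥ (Xᵀ *ᵥ z)) (Xᵀ *ᵥ z)) W := by
  have hRt : (X * Wᵀ)ᵀ = X * Wᵀ := by rw [transpose_mul, transpose_transpose, h.symm]
  have h1 : (vecMulVec (W *ᵥ (Xᵀ *ᵥ z)) (Xᵀ *ᵥ z)) * Wᵀ =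
      vecMulVec ((X * Wᵀ) *ᵥ z) ((X * Wᵀ) *ᵥ z) := by
    rw [vecMulVec_mul, vecMul_transpose, mulVec_mulVec, h.symm]
  have h2 : (vecMulVec (W *ᵥ (Xᵀ *ᵥ z)) (Xᵀ *ᵥ z)) * Wᵀ * W =
      vecMulVec (W *ᵥ (Xᵀ *ᵥ z)) (Xᵀ *ᵥ z) := by
    have h3 : Wᵀ * (W * Xᵀ) = Xᵀ := by
      conv_rhs => rw [← h.mul_transpose_mul]
      rw [transpose_mul, transpose_mul, transpose_transpose]
    rw [h1, vecMulVec_mul, mulVec_mulVec, h.symm, ← mulVec_transpose, mulVec_mulVec, ← h.symm, h3]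
  have h1' : W * (vecMulVec (W *ᵥ (Xᵀ *ᵥ z)) (Xᵀ *ᵥ z))ᵀ =
      vecMulVec ((X * Wᵀ) *ᵥ z) ((X * Wᵀ) *ᵥ z) := by
    rw [← transpose_transpose (W * _), transpose_mul, transpose_transpose, h1, transpose_vecMulVec]
  refine ⟨h.contraction, ?_, fun p => ?_, ?_⟩
  · rw [transpose_add, Matrix.mul_add, Matrix.add_mul, h.symm, transpose_smul, Matrix.smul_mul, h1,
      Matrix.mul_smul, h1']
  · rw [Matrix.add_mul, Matrix.smul_mul, h1, add_mulVec, smul_mulVec, vecMulVec_mulVec',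
      dotProduct_add, dotProduct_smul, dotProduct_smul, smul_eq_mul, smul_eq_mul,
      dotProduct_comm _ p]
    -- With `R = X Wᵀ`, Cauchy–Schwarz for the form of `R` bounds the rank-one term; for `t ≤ 0` it
    -- leaves at least `(1 + t z ⬝ R z) (p ⬝ R p)`.
    have h3 := sq_dotProduct_mulVec_le hRt h.nonneg p z
    have h4 := h.nonneg p
    rcases le_total 0 t with h5 | h5
    · nlinarith [mul_nonneg h5 (sq_nonneg (p ⬝ᵥ (X * Wᵀ) *ᵥ z))]
    · nlinarith
  · rw [Matrix.add_mul, Matrix.add_mul, h.mul_transpose_mul, Matrix.smul_mul, Matrix.smul_mul, h2]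

/-- The perturbation of `X` is admissible for small coefficients of either sign, so the test
inequality becomes an equality. -/
theorem regularNormal_dotProduct_eq_zero {m n : ℕ} (hmn : m ≤ n) {u v X W : Matrix (Fin m) (Fin n) ℝ}
    (hP : IsPolarPair X W)
    (hN : WithLp.toLp 2 (u, v) ∈ regularNormalCone (gph nuclearSubdiff) (WithLp.toLp 2 (X, W)))
    (z : Fin m → ℝ) : (W *ᵥ (Xᵀ *ᵥ z)) ⬝ᵥ (u *ᵥ (Xᵀ *ᵥ z)) = 0 := by
  have key : ∀ c : ℝ, c * ((W *ᵥ (Xᵀ *ᵥ z)) ⬝ᵥ (u *ᵥ (Xᵀ *ᵥ z))) ≤ 0 := by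
    intro c
    have h1 := inner_add_inner_le_zero hmn hN (by simp) rfl
      (hasVelocity_add_smul X (c • vecMulVec (W *ᵥ (Xᵀ *ᵥ z)) (Xᵀ *ᵥ z))) (hasVelocity_const W) (by
        have hc : Continuous fun t : ℝ => 1 + t * c * (z ⬝ᵥ (X * Wᵀ) *ᵥ z) := by fun_prop
        have := (hc.tendsto 0).eventually (lt_mem_nhds (a := 0) (by simp))
        filter_upwards [nhdsWithin_le_nhds this] with t ht
        rw [smul_smul]
        exact hP.add_smul_vecMulVec z ht.le)
    rwa [inner_zero_right, add_zero, inner_smul_right, inner_vecMulVec] at h1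
  linarith [key 1, key (-1)]

/-- Shrinking `W` in a direction of the kernel of `X`. -/
theorem IsPolarPair.sub_smul_vecMulVec {m n : ℕ} {X W : Matrix (Fin m) (Fin n) ℝ}
    (h : IsPolarPair X W) {y : Fin n → ℝ} (hy : X *ᵥ y = 0) {t : ℝ} (ht : 0 ≤ t)
    (hty : t * (y ⬝ᵥ y) ≤ 1) : IsPolarPair X (W + t • -vecMulVec (W *ᵥ y) y) := by
  have h1 : X * (W + t • -vecMulVec (W *ᵥ y) y)ᵀ = X * Wᵀ := by
    rw [transpose_add, Matrix.mul_add, transpose_smul, transpose_neg, transpose_vecMulVec,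
      Matrix.mul_smul, Matrix.mul_neg, mul_vecMulVec, hy]
    simp
  refine ⟨fun x => ?_, ?_, ?_, ?_⟩
  -- The new matrix is `W (1 - t y yᵀ)`, and the second factor is a contraction for `t |y|² ≤ 1`.
  · have h2 : (W + t • -vecMulVec (W *ᵥ y) y) *ᵥ x = W *ᵥ (x - (t * (y ⬝ᵥ x)) • y) := by
      rw [add_mulVec, smul_mulVec, neg_mulVec, vecMulVec_mulVec', mulVec_sub, mulVec_smul]
      module
    rw [h2]
    refine (h.contraction _).trans ?_
    simp only [sub_dotProduct, dotProduct_sub, smul_dotProduct, dotProduct_smul, smul_eq_mul,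
      dotProduct_comm x y]
    nlinarith [mul_nonneg ht (sq_nonneg (y ⬝ᵥ x)),
      mul_le_mul_of_nonneg_right hty (mul_nonneg ht (sq_nonneg (y ⬝ᵥ x)))]
  · rw [h1, ← transpose_transpose ((W + t • -vecMulVec (W *ᵥ y) y) * Xᵀ), transpose_mul,
      transpose_transpose, h1, transpose_mul, transpose_transpose, h.symm]
  · rw [h1]; exact h.nonneg
  · rw [h1, Matrix.mul_add, Matrix.mul_smul, Matrix.mul_neg, mul_vecMulVec, mulVec_mulVec,
      h.mul_transpose_mul, hy]
    simp

theorem regularNormal_dotProduct_nonneg {m n : ℕ} (hmn : m ≤ n) {u v X W : Matrix (Fin m) (Fin n) ℝ}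
    (hP : IsPolarPair X W)
    (hN : WithLp.toLp 2 (u, v) ∈ regularNormalCone (gph nuclearSubdiff) (WithLp.toLp 2 (X, W)))
    {y : Fin n → ℝ} (hy : X *ᵥ y = 0) : 0 ≤ (W *ᵥ y) ⬝ᵥ (v *ᵥ y) := by
  have h1 := inner_add_inner_le_zero hmn hN (γ := fun _ => X) (δ := fun t => W + t • -vecMulVec (W *ᵥ y) y) rfl
    (by simp) (hasVelocity_const X) (hasVelocity_add_smul W (-vecMulVec (W *ᵥ y) y)) (by
      have hc : Continuous fun t : ℝ => t * (y ⬝ᵥ y) := by fun_prop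
      have := (hc.tendsto' 0 0 (by simp)).eventually (gt_mem_nhds one_pos)
      filter_upwards [nhdsWithin_le_nhds this, self_mem_nhdsWithin] with t ht ht0
      exact hP.sub_smul_vecMulVec hy (le_of_lt ht0) ht.le)
  rw [inner_zero_right, zero_add, inner_neg_right, inner_vecMulVec] at h1
  linarith

theorem mulVec_dotProduct_self_le {m n : ℕ} (P : Matrix (Fin m) (Fin n) ℝ) (x : Fin n → ℝ) :
    (P *ᵥ x) ⬝ᵥ (P *ᵥ x) ≤ ‖Pᵀ * P‖ * (x ⬝ᵥ x) := by
  have := dotProduct_mulVec_le (Pᵀ * P) x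
  rwa [← mulVec_mulVec, dotProduct_mulVec_eq, transpose_transpose] at this

/-- Moving `W` within its singular values smaller than one. -/
theorem IsPolarPair.add_smul_of_lt_one {m n : ℕ} {X W : Matrix (Fin m) (Fin n) ℝ}
    (h : IsPolarPair X W) (H : Matrix (Fin m) (Fin n) ℝ) :
    ∀ᶠ t : ℝ in nhdsWithin 0 (Set.Ioi 0),
      IsPolarPair X (W + t • ((1 - W * Wᵀ) * H * (1 - Wᵀ * W))) := by
  obtain ⟨G, hG⟩ : ∃ G, G = 1 - Wᵀ * W := ⟨_, rfl⟩
  obtain ⟨A, hA⟩ : ∃ A, A = (1 - W * Wᵀ) * H * (1 - Wᵀ * W) := ⟨_, rfl⟩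
  have hXA : X * Aᵀ = 0 := by
    have : X * (1 - Wᵀ * W) = 0 := by
      rw [Matrix.mul_sub, Matrix.mul_one, ← Matrix.mul_assoc, h.mul_transpose_mul, sub_self]
    rw [hA, transpose_mul, transpose_sub, transpose_one, transpose_mul, transpose_transpose,
      ← Matrix.mul_assoc, this, Matrix.zero_mul]
  have hXWA : X * Wᵀ * A = 0 := by
    have : X * Wᵀ * (1 - W * Wᵀ) = 0 := by
      rw [Matrix.mul_sub, Matrix.mul_one, ← Matrix.mul_assoc, h.mul_transpose_mul, sub_self]
    rw [hA, Matrix.mul_assoc _ H, ← Matrix.mul_assoc, this, Matrix.zero_mul]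
  have hWA : Wᵀ * A = Gᵀ * (Wᵀ * H) * G := by
    rw [hA, hG]
    simp only [transpose_sub, transpose_one, transpose_mul, transpose_transpose, Matrix.mul_sub,
      Matrix.sub_mul, Matrix.mul_one, Matrix.one_mul, Matrix.mul_assoc]
  -- On singular values this says `(1 - σ²)² ≤ 1 - σ²`: the slack in the contraction inequality for
  -- `W` dominates `|G x|²`.
  have hGx : ∀ x, (G *ᵥ x) ⬝ᵥ (G *ᵥ x) ≤ x ⬝ᵥ x - (W *ᵥ x) ⬝ᵥ (W *ᵥ x) := by
    intro x
    have h1 := h.contraction.transpose (W *ᵥ x)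
    have h2 : x ⬝ᵥ Wᵀ *ᵥ W *ᵥ x = (W *ᵥ x) ⬝ᵥ (W *ᵥ x) := by
      rw [dotProduct_mulVec_eq, transpose_transpose]
    rw [hG, sub_mulVec, one_mulVec, ← mulVec_mulVec, sub_dotProduct, dotProduct_sub, dotProduct_sub,
      dotProduct_comm (Wᵀ *ᵥ W *ᵥ x) x, h2]
    linarith
  -- Both the cross term and the quadratic term in `t` are bounded by multiples of `|G x|²`; the
  -- condition on `t` keeps their sum within the slack.
  have hbound : ∀ x (t : ℝ), 0 < t → t * (2 * ‖Wᵀ * H‖ +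
      t * ‖((1 - W * Wᵀ) * H)ᵀ * ((1 - W * Wᵀ) * H)‖) ≤ 1 →
      ((W + t • A) *ᵥ x) ⬝ᵥ ((W + t • A) *ᵥ x) ≤ x ⬝ᵥ x := by
    intro x t ht hc
    have h1 : (W *ᵥ x) ⬝ᵥ (A *ᵥ x) ≤ ‖Wᵀ * H‖ * ((G *ᵥ x) ⬝ᵥ (G *ᵥ x)) := by
      have h0 : (W *ᵥ x) ⬝ᵥ (A *ᵥ x) = (G *ᵥ x) ⬝ᵥ (Wᵀ * H) *ᵥ (G *ᵥ x) := by
        calc (W *ᵥ x) ⬝ᵥ (A *ᵥ x) = x ⬝ᵥ (Wᵀ * A) *ᵥ x := by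
              rw [← mulVec_mulVec, dotProduct_mulVec_eq _ x, transpose_transpose]
          _ = _ := by
              rw [hWA, ← mulVec_mulVec, ← mulVec_mulVec, dotProduct_mulVec_eq _ x, transpose_transpose]
      rw [h0]
      exact dotProduct_mulVec_le (Wᵀ * H) (G *ᵥ x)
    have h2 : (A *ᵥ x) ⬝ᵥ (A *ᵥ x) ≤
        ‖((1 - W * Wᵀ) * H)ᵀ * ((1 - W * Wᵀ) * H)‖ * ((G *ᵥ x) ⬝ᵥ (G *ᵥ x)) := by
      have := mulVec_dotProduct_self_le ((1 - W * Wᵀ) * H) (G *ᵥ x)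
      rwa [mulVec_mulVec, hG, ← hA, ← hG] at this
    have h3 := hGx x
    have h4 := dotProduct_self_nonneg' (G *ᵥ x)
    rw [add_mulVec, smul_mulVec, add_dotProduct, dotProduct_add, dotProduct_add, smul_dotProduct,
      dotProduct_smul, smul_dotProduct, dotProduct_smul, dotProduct_comm (A *ᵥ x) (W *ᵥ x)]
    simp only [smul_eq_mul]
    have h5 := mul_le_mul_of_nonneg_right hc h4
    have h6 := mul_le_mul_of_nonneg_left h1 ht.le
    have h7 := mul_le_mul_of_nonneg_left h2 (mul_pos ht ht).le
    linarith
  have hc : Continuous fun t : ℝ => t * (2 * ‖Wᵀ * H‖ +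
      t * ‖((1 - W * Wᵀ) * H)ᵀ * ((1 - W * Wᵀ) * H)‖) := by fun_prop
  have := (hc.tendsto' 0 0 (by simp)).eventually (gt_mem_nhds one_pos)
  filter_upwards [nhdsWithin_le_nhds this, self_mem_nhdsWithin] with t ht ht0
  rw [← hA]
  have h1 : X * (W + t • A)ᵀ = X * Wᵀ := by
    rw [transpose_add, Matrix.mul_add, transpose_smul, Matrix.mul_smul, hXA, smul_zero, add_zero]
  refine ⟨fun x => hbound x t ht0 ht.le, ?_, ?_, ?_⟩
  · rw [h1, ← transpose_transpose ((W + t • A) * Xᵀ), transpose_mul,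
      transpose_transpose, h1, transpose_mul, transpose_transpose, h.symm]
  · rw [h1]; exact h.nonneg
  · rw [h1, Matrix.mul_add, Matrix.mul_smul, hXWA, smul_zero, add_zero, h.mul_transpose_mul]

theorem inner_mul_mul_eq {m n : ℕ} (v H : Matrix (Fin m) (Fin n) ℝ) (P : Matrix (Fin m) (Fin m) ℝ)
    (Q : Matrix (Fin n) (Fin n) ℝ) : inner ℝ v (P * H * Q) = inner ℝ (Pᵀ * v * Qᵀ) H := by
  rw [inner_eq_trace, inner_eq_trace]
  simp only [transpose_mul, transpose_transpose, Matrix.mul_assoc]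
  rw [trace_mul_comm Q]
  simp only [Matrix.mul_assoc]

/-- The middle matrix of the perturbation is chosen as the sandwiched `v` itself, so the tested
inner product is a squared norm. -/
theorem regularNormal_mul_mul_eq_zero {m n : ℕ} (hmn : m ≤ n) {u v X W : Matrix (Fin m) (Fin n) ℝ}
    (hP : IsPolarPair X W)
    (hN : WithLp.toLp 2 (u, v) ∈ regularNormalCone (gph nuclearSubdiff) (WithLp.toLp 2 (X, W))) :
    (1 - W * Wᵀ) * v * (1 - Wᵀ * W) = 0 := by
  obtain ⟨K, hK⟩ : ∃ K, K = (1 - W * Wᵀ) * v * (1 - Wᵀ * W) := ⟨_, rfl⟩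
  have h1 := inner_add_inner_le_zero hmn hN (γ := fun _ => X)
    (δ := fun t => W + t • ((1 - W * Wᵀ) * K * (1 - Wᵀ * W))) rfl (by simp) (hasVelocity_const X)
    (hasVelocity_add_smul W _) (hP.add_smul_of_lt_one K)
  have h2 : inner ℝ v ((1 - W * Wᵀ) * K * (1 - Wᵀ * W)) = inner ℝ K K := by
    have h3 : (1 - W * Wᵀ)ᵀ = 1 - W * Wᵀ := by simp
    have h4 : (1 - Wᵀ * W)ᵀ = 1 - Wᵀ * W := by simp
    rw [inner_mul_mul_eq, h3, h4, ← hK]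
  rw [inner_zero_right, zero_add, h2, real_inner_self_nonpos] at h1
  rw [← hK, h1]

/-- The pointwise information carried by a limiting normal to the graph. -/
theorem exists_seq_of_mem_normalCone {m n : ℕ} (hmn : m ≤ n) {u v X W : Matrix (Fin m) (Fin n) ℝ}
    (hN : WithLp.toLp 2 (u, v) ∈ normalCone (gph nuclearSubdiff) (WithLp.toLp 2 (X, W))) :
    ∃ us vs Xs Ws : ℕ → Matrix (Fin m) (Fin n) ℝ,
      Filter.Tendsto us Filter.atTop (nhds u) ∧ Filter.Tendsto vs Filter.atTop (nhds v) ∧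
      Filter.Tendsto Xs Filter.atTop (nhds X) ∧ Filter.Tendsto Ws Filter.atTop (nhds W) ∧
      (∀ k, IsPolarPair (Xs k) (Ws k)) ∧
      ∀ k, WithLp.toLp 2 (us k, vs k) ∈
        regularNormalCone (gph nuclearSubdiff) (WithLp.toLp 2 (Xs k, Ws k)) := by
  obtain ⟨-, zs, ws, hz, hzt, hwt, hr⟩ := hN
  have hc := WithLp.prod_continuous_ofLp 2 (Matrix (Fin m) (Fin n) ℝ) (Matrix (Fin m) (Fin n) ℝ)
  have h1 := (hc.tendsto _).comp hzt
  have h2 := (hc.tendsto _).comp hwt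
  exact ⟨fun k => (ws k).fst, fun k => (ws k).snd, fun k => (zs k).fst, fun k => (zs k).snd,
    (continuous_fst.tendsto _).comp h2, (continuous_snd.tendsto _).comp h2,
    (continuous_fst.tendsto _).comp h1, (continuous_snd.tendsto _).comp h1,
    fun k => (mem_nuclearSubdiff_iff hmn).1 (hz k), hr⟩

/-! ### The spectral function: orthogonal invariance and restriction to singular pairs. -/

/-- As a sum over an unordered multiset of roots, the function is controlled under rotations and
rank-one updates by characteristic polynomials alone, without tracking the order of singular values.
-/
theorem phiHatSv_eq_sum_roots {m n : ℕ} (hmn : m ≤ n) (φ : ℝ → EReal)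
    (W : Matrix (Fin m) (Fin n) ℝ) :
    phiHatSv φ W = ((W * Wᵀ).charpoly.roots.map fun x => phiHat φ √x).sum :=
  sum_sv_eq_sum_roots hmn W (phiHat φ)

theorem phiHatSv_orthogonal_mul {m n : ℕ} (hmn : m ≤ n) (φ : ℝ → EReal)
    (W : Matrix (Fin m) (Fin n) ℝ) {U : Matrix (Fin m) (Fin m) ℝ} (hU : Uᵀ * U = 1) :
    phiHatSv φ (U * W) = phiHatSv φ W := by
  rw [phiHatSv_eq_sum_roots hmn, phiHatSv_eq_sum_roots hmn, transpose_mul, Matrix.mul_assoc,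
    charpoly_mul_comm, ← Matrix.mul_assoc, Matrix.mul_assoc, hU, Matrix.mul_one]

theorem phiHatSv_mul_orthogonal {m n : ℕ} (hmn : m ≤ n) (φ : ℝ → EReal)
    (W : Matrix (Fin m) (Fin n) ℝ) {V : Matrix (Fin n) (Fin n) ℝ} (hV : V * Vᵀ = 1) :
    phiHatSv φ (W * V) = phiHatSv φ W := by
  rw [phiHatSv_eq_sum_roots hmn, phiHatSv_eq_sum_roots hmn, transpose_mul, Matrix.mul_assoc,
    ← Matrix.mul_assoc V, hV, Matrix.one_mul]

theorem inner_le_zero_of_mem_regularSubdiff {E : Type*} [NormedAddCommGroup E]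
    [InnerProductSpace ℝ E] {g : E → EReal} {z v : E} (hv : v ∈ regularSubdiff g z) {γ : ℝ → E}
    {γ' : E} (h0 : γ 0 = z) (hd : HasVelocity γ γ') (hg : ∀ t, g (γ t) = g z) :
    inner ℝ v γ' ≤ 0 :=
  inner_le_zero_of_mem_regularNormalCone (regularSubdiff_subset_regularNormalCone g z hv) h0 hd
    (Filter.Eventually.of_forall fun t => (hg t).le)

theorem mul_transpose_symm_of_mem_regularSubdiff {m n : ℕ} (hmn : m ≤ n) {φ : ℝ → EReal}
    {W D : Matrix (Fin m) (Fin n) ℝ} (hD : D ∈ regularSubdiff (phiHatSv φ) W) :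
    (D * Wᵀ)ᵀ = D * Wᵀ := by
  refine eq_transpose_of_inner_le_zero fun A hA => ?_
  rw [← inner_mul_left_eq]
  exact inner_le_zero_of_mem_regularSubdiff hD (by simp) (hasVelocity_exp_smul_mul A W)
    fun t => phiHatSv_orthogonal_mul hmn φ W (exp_smul_transpose_mul_self hA t)

theorem transpose_mul_symm_of_mem_regularSubdiff {m n : ℕ} (hmn : m ≤ n) {φ : ℝ → EReal}
    {W D : Matrix (Fin m) (Fin n) ℝ} (hD : D ∈ regularSubdiff (phiHatSv φ) W) :
    (Wᵀ * D)ᵀ = Wᵀ * D := by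
  refine eq_transpose_of_inner_le_zero fun A hA => ?_
  rw [← inner_mul_right_eq]
  exact inner_le_zero_of_mem_regularSubdiff hD (by simp) (hasVelocity_mul_exp_smul A W)
    fun t => phiHatSv_mul_orthogonal hmn φ W (exp_smul_mul_transpose hA t)

theorem multiset_sum_ne_bot {s : Multiset EReal} (h : ∀ x ∈ s, x ≠ ⊥) : s.sum ≠ ⊥ := by
  induction s using Multiset.induction with
  | empty => simp
  | cons a s ih =>
    rw [Multiset.sum_cons, Ne, EReal.add_eq_bot_iff, not_or]
    exact ⟨h a (Multiset.mem_cons_self a s), ih fun x hx => h x (Multiset.mem_cons_of_mem hx)⟩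

/-- Along a singular pair only one singular value moves. -/
theorem exists_phiHatSv_add_smul_vecMulVec {m n : ℕ} (hmn : m ≤ n) {φ : ℝ → EReal}
    (hφ : ∀ t, φ t ≠ ⊥) {W : Matrix (Fin m) (Fin n) ℝ} {u : Fin m → ℝ} {v : Fin n → ℝ} {ω : ℝ}
    (hu : u ⬝ᵥ u = 1) (hv : v ⬝ᵥ v = 1) (h1 : W *ᵥ v = ω • u) (h2 : Wᵀ *ᵥ u = ω • v) :
    ∃ S : EReal, S ≠ ⊥ ∧ ∀ t : ℝ, phiHatSv φ (W + t • vecMulVec u v) = phiHat φ (ω + t) + S := by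
  obtain ⟨H, hH⟩ : ∃ H, H = W * Wᵀ := ⟨_, rfl⟩
  have hHu : H *ᵥ u = ω ^ 2 • u := by
    rw [hH, ← mulVec_mulVec, h2, mulVec_smul, h1, smul_smul, pow_two]
  have hW : ∀ t : ℝ, (W + t • vecMulVec u v) * (W + t • vecMulVec u v)ᵀ =
      H + ((ω + t) ^ 2 - ω ^ 2) • vecMulVec u u := by
    intro t
    rw [transpose_add, transpose_smul, transpose_vecMulVec, Matrix.mul_add, Matrix.add_mul,
      Matrix.add_mul, Matrix.smul_mul, Matrix.mul_smul, Matrix.mul_smul, Matrix.smul_mul,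
      vecMulVec_mul, vecMul_transpose, mul_vecMulVec, h1, vecMulVec_mul_vecMulVec, hv, ← hH]
    simp only [vecMulVec_smul, smul_vecMulVec]
    module
  have hroot : ω ^ 2 ∈ H.charpoly.roots := by
    rw [Polynomial.mem_roots (charpoly_monic H).ne_zero, Polynomial.IsRoot.def, eval_charpoly]
    refine exists_mulVec_eq_zero_iff.1 ⟨u, fun h => by simp [h] at hu, ?_⟩
    rw [sub_mulVec, sub_eq_zero, scalar_apply, ← smul_one_eq_diagonal, smul_mulVec, one_mulVec, hHu]
  obtain ⟨s, hs⟩ := Multiset.exists_cons_of_mem hroot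
  refine ⟨(s.map fun x => phiHat φ √x).sum, multiset_sum_ne_bot ?_, fun t => ?_⟩
  · intro x hx
    obtain ⟨y, -, rfl⟩ := Multiset.mem_map.1 hx
    exact hφ _
  · have h3 := congrArg Polynomial.roots
      (charpoly_add_smul_vecMulVec H u (ω ^ 2) ((ω + t) ^ 2 - ω ^ 2) hu hHu)
    rw [Polynomial.roots_mul (mul_ne_zero (charpoly_monic _).ne_zero (Polynomial.X_sub_C_ne_zero _)),
      Polynomial.roots_mul (mul_ne_zero (charpoly_monic _).ne_zero (Polynomial.X_sub_C_ne_zero _)),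
      Polynomial.roots_X_sub_C, Polynomial.roots_X_sub_C, hs, add_sub_cancel, add_comm, add_comm _ {_},
      Multiset.singleton_add, Multiset.singleton_add, Multiset.cons_swap, Multiset.cons_inj_right]
      at h3
    rw [phiHatSv_eq_sum_roots hmn, hW, h3, Multiset.map_cons, Multiset.sum_cons, Real.sqrt_sq_eq_abs,
      phiHat, abs_abs]
    rfl

/-- Regular subgradients of the spectral function restrict to regular subgradients of `φ̂` along
singular pairs. -/
theorem mem_regularSubdiff_phiHat {m n : ℕ} (hmn : m ≤ n) {φ : ℝ → EReal}
    (hφ : ∀ t, φ t ≠ ⊥) {W D : Matrix (Fin m) (Fin n) ℝ}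
    (hD : D ∈ regularSubdiff (phiHatSv φ) W) {u : Fin m → ℝ} {v : Fin n → ℝ} {ω : ℝ}
    (hu : u ⬝ᵥ u = 1) (hv : v ⬝ᵥ v = 1) (h1 : W *ᵥ v = ω • u) (h2 : Wᵀ *ᵥ u = ω • v) :
    u ⬝ᵥ D *ᵥ v ∈ regularSubdiff (phiHat φ) ω := by
  obtain ⟨S, hS, hsum⟩ := exists_phiHatSv_add_smul_vecMulVec hmn hφ hu hv h1 h2
  have h0 := hsum 0
  rw [zero_smul, add_zero, add_zero] at h0
  obtain ⟨hb, ht, hD⟩ := hD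
  rw [h0] at ht
  have hωb : phiHat φ ω ≠ ⊥ := hφ _
  have hωt : phiHat φ ω ≠ ⊤ := fun h => ht (by rw [h, EReal.top_add_of_ne_bot hS])
  have hSt : S ≠ ⊤ := fun h => ht (by rw [h, EReal.add_top_of_ne_bot hωb])
  refine ⟨hωb, hωt, fun ε hε => ?_⟩
  have hc : Continuous fun z : ℝ => W + (z - ω) • vecMulVec u v := by fun_prop
  filter_upwards [(hc.tendsto' ω W (by simp)).eventually (hD ε hε)] with z hz
  have hn : ‖vecMulVec u v‖ = 1 := by
    rw [← sq_eq_sq₀ (norm_nonneg _) zero_le_one, norm_vecMulVec, hu, hv]; norm_num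
  rw [h0, hsum, add_sub_cancel, add_sub_cancel_left, inner_smul_right, inner_vecMulVec, norm_smul,
    hn, mul_one] at hz
  lift S to ℝ using ⟨hSt, hS⟩ with S'
  lift phiHat φ ω to ℝ using ⟨hωt, hωb⟩ with c
  have h5 : inner ℝ (u ⬝ᵥ D *ᵥ v) (z - ω) = (z - ω) * (u ⬝ᵥ D *ᵥ v) := by simp
  rw [h5]
  have hzb : phiHat φ z ≠ ⊥ := hφ _
  generalize phiHat φ z = e at hz hzb ⊢
  induction e with
  | bot => exact absurd rfl hzb
  | top => simp
  | coe d =>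
    norm_cast at hz ⊢
    linarith

/-! ### One-variable subgradient estimates. -/

/-- Near `[0, 1]` a function of the family is real-valued and convex. -/
theorem IsL.exists_convexOn {φ : ℝ → EReal} (hφ : IsL φ) :
    ∃ δ : ℝ, 0 < δ ∧ (∀ t ∈ Set.Ioo (-δ) (1 + δ), φ t = ((φ t).toReal : EReal)) ∧
      ConvexOn ℝ (Set.Ioo (-δ) (1 + δ)) fun s => (φ s).toReal := by
  have h0 := mem_interior_iff_mem_nhds.1 (hφ.dom ⟨le_rfl, zero_le_one⟩)
  have h1 := mem_interior_iff_mem_nhds.1 (hφ.dom ⟨zero_le_one, le_rfl⟩)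
  obtain ⟨a, ha, h0⟩ := Metric.mem_nhds_iff.1 h0
  obtain ⟨b, hb, h1⟩ := Metric.mem_nhds_iff.1 h1
  have hfin : ∀ t ∈ Set.Ioo (-min a b) (1 + min a b), φ t = ((φ t).toReal : EReal) := by
    intro t ht
    refine (EReal.coe_toReal (ne_of_lt ?_) (hφ.ne_bot t)).symm
    have ht1 : -a < t := (neg_le_neg (min_le_left a b)).trans_lt ht.1
    have ht2 : t < 1 + b := ht.2.trans_le (by linarith [min_le_right a b])
    rcases lt_or_ge t 0 with h | h
    · exact h0 (by rw [Metric.mem_ball, Real.dist_eq, abs_lt]; constructor <;> linarith)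
    rcases le_or_gt t 1 with h' | h'
    · have h2 : t ∈ {t | φ t < ⊤} := interior_subset (hφ.dom ⟨h, h'⟩)
      exact h2
    · exact h1 (by rw [Metric.mem_ball, Real.dist_eq, abs_lt]; constructor <;> linarith)
  refine ⟨min a b, lt_min ha hb, hfin, convex_Ioo _ _, ?_⟩
  intro x hx y hy p q hp hq hpq
  have h2 := hφ.convex_epi (x := (x, (φ x).toReal)) (hfin x hx).le
    (y := (y, (φ y).toReal)) (hfin y hy).le hp hq hpq
  have h3 : φ (p • x + q • y) ≤ ((p • (φ x).toReal + q • (φ y).toReal : ℝ) : EReal) := h2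
  rwa [hfin _ (convex_Ioo _ _ hx hy hp hq hpq), EReal.coe_le_coe_iff] at h3

/-- Near `ω > 0` the functions `φ̂` and `φ` agree, so convexity of `φ` extends the inequality to the
whole interval, negative `t` included. -/
theorem add_mul_le_of_mem_regularSubdiff_phiHat {φ : ℝ → EReal} {δ : ℝ}
    (hfin : ∀ t ∈ Set.Ioo (-δ) (1 + δ), φ t = ((φ t).toReal : EReal))
    (hcv : ConvexOn ℝ (Set.Ioo (-δ) (1 + δ)) fun s => (φ s).toReal) {ω d t : ℝ} (hω : 0 < ω)
    (hωI : ω ∈ Set.Ioo (-δ) (1 + δ)) (hd : d ∈ regularSubdiff (phiHat φ) ω)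
    (ht : t ∈ Set.Ioo (-δ) (1 + δ)) : (φ ω).toReal + d * (t - ω) ≤ (φ t).toReal := by
  have h := le_of_mem_regularSubdiff (y := t) (b := (φ t).toReal) hd
    (by rw [phiHat, abs_of_pos hω]; exact hfin ω hωI) (by
      have hc : Continuous fun s : ℝ => ω + s • (t - ω) := by fun_prop
      filter_upwards [Ioo_mem_nhdsGT (zero_lt_one' ℝ),
        nhdsWithin_le_nhds ((hc.tendsto' 0 ω (by simp)).eventually (lt_mem_nhds hω))] with s hs hs'
      have h1 : ω + s • (t - ω) = (1 - s) • ω + s • t := by simp only [smul_eq_mul]; ring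
      rw [phiHat, abs_of_pos hs', h1]
      have hs0 : 0 ≤ 1 - s := by linarith [hs.2]
      rw [hfin _ (convex_Ioo _ _ hωI ht hs0 hs.1.le (by ring)), EReal.coe_le_coe_iff]
      refine (hcv.2 hωI ht hs0 hs.1.le (by ring)).trans (le_of_eq ?_)
      simp only [smul_eq_mul]; ring)
  have h2 : inner ℝ d (t - ω) = d * (t - ω) := by simp [mul_comm]
  rwa [h2] at h

/-- By convexity the derivative at `1` is at least the secant slope from the minimizer `t* < 1`,
which is `1 / (1 - t*)`. -/
theorem IsL1.deriv_one_pos {φ : ℝ → EReal} (hφ : IsL1 φ) :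
    0 < deriv (fun s => (φ s).toReal) 1 := by
  obtain ⟨δ, hδ, hfin, hcv⟩ := hφ.exists_convexOn
  obtain ⟨t, ht, ht1, -, ht0⟩ := hφ.argmin
  have hd := (hφ.differentiable 1 ⟨one_pos, le_rfl⟩).hasDerivAt
  have h := hcv.slope_le_of_hasDerivAt (x := t) (y := 1) ⟨by linarith [ht.1], by linarith⟩
    ⟨by linarith, by linarith⟩ ht1 hd
  refine lt_of_lt_of_le ?_ h
  rw [slope_def_field, ht0, hφ.one]
  simpa using ht1

/-- Regular subgradients of `φ̂` near a point of `(0, 1]` are close to the derivative there. -/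
theorem IsL1.eventually_abs_sub_deriv_le {φ : ℝ → EReal} (hφ : IsL1 φ) {s : ℝ}
    (hs : s ∈ Set.Ioc (0 : ℝ) 1) {ε : ℝ} (hε : 0 < ε) :
    ∀ᶠ ω in nhds s, ∀ d ∈ regularSubdiff (phiHat φ) ω,
      |d - deriv (fun s => (φ s).toReal) s| ≤ ε := by
  obtain ⟨δ, hδ, hfin, hcv⟩ := hφ.exists_convexOn
  set ψ : ℝ → ℝ := fun s => (φ s).toReal with hψ
  have hd := (hφ.differentiable s hs).hasDerivAt
  have hsl := hasDerivAt_iff_tendsto_slope.1 hd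
  have hI : Set.Ioo (-δ) (1 + δ) ∈ nhds s :=
    Ioo_mem_nhds (by linarith [hs.1]) (by linarith [hs.2])
  -- Fixed points `q < s < p` with secant slopes close to the derivative: a subgradient at `ω` lies
  -- between the slopes from `ω` to `q` and to `p`, which depend continuously on `ω`.
  obtain ⟨p, ⟨hp1, hp2⟩, hp3⟩ := (((hsl.mono_left (nhdsGT_le_nhdsNE s)).eventually
    (gt_mem_nhds (lt_add_of_pos_right _ hε))).and (nhdsWithin_le_nhds hI)).and
      self_mem_nhdsWithin |>.exists
  obtain ⟨q, ⟨hq1, hq2⟩, hq3⟩ := (((hsl.mono_left (nhdsLT_le_nhdsNE s)).eventually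
    (lt_mem_nhds (sub_lt_self _ hε))).and (nhdsWithin_le_nhds hI)).and
      self_mem_nhdsWithin |>.exists
  have hp3 : s < p := hp3
  have hq3 : q < s := hq3
  have hcont : ∀ y, y ≠ s → Filter.Tendsto (fun ω => slope ψ ω y) (nhds s) (nhds (slope ψ s y)) := by
    intro y hy
    simp only [slope_def_field]
    exact (tendsto_const_nhds.sub hd.continuousAt).div (tendsto_const_nhds.sub Filter.tendsto_id)
      (sub_ne_zero.2 hy)
  filter_upwards [(hcont p hp3.ne').eventually (gt_mem_nhds hp1),
    (hcont q hq3.ne).eventually (lt_mem_nhds hq1), hI, Ioo_mem_nhds hq3 hp3, lt_mem_nhds hs.1]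
    with ω h1 h2 h3 h4 h5 d hd
  have h6 := add_mul_le_of_mem_regularSubdiff_phiHat hfin hcv h5 h3 hd hp2
  have h7 := add_mul_le_of_mem_regularSubdiff_phiHat hfin hcv h5 h3 hd hq2
  rw [slope_def_field, div_lt_iff₀ (by linarith [h4.2])] at h1
  rw [slope_def_field, lt_div_iff_of_neg (by linarith [h4.1])] at h2
  rw [abs_le]
  constructor
  · by_contra! h8
    nlinarith [h4.1]
  · by_contra! h8
    nlinarith [h4.2]

/-- If zero is not a limiting subgradient of `φ̂` at zero, then `φ̂` has a downward kink there. -/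
theorem IsL.exists_le_neg_of_zero_notMem_subdiff {φ : ℝ → EReal} (hφ : IsL φ)
    (h : (0 : ℝ) ∉ subdiff (phiHat φ) 0) :
    (∀ d, d ∉ regularSubdiff (phiHat φ) 0) ∧
      ∃ c : ℝ, 0 < c ∧ ∀ᶠ ω in nhds (0 : ℝ), 0 < ω → ∀ d ∈ regularSubdiff (phiHat φ) ω, d ≤ -c := by
  obtain ⟨δ, hδ, hfin, hcv⟩ := hφ.exists_convexOn
  have h0I : (0 : ℝ) ∈ Set.Ioo (-δ) (1 + δ) := ⟨by linarith, by linarith⟩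
  have hφ0 : phiHat φ 0 = ((φ 0).toReal : EReal) := by rw [phiHat, abs_zero]; exact hfin 0 h0I
  have h0 : (0 : ℝ) ∉ regularSubdiff (phiHat φ) 0 := fun hr => h
    ⟨hr.1, hr.2.1, fun _ => 0, fun _ => 0, tendsto_const_nhds, tendsto_const_nhds,
      tendsto_const_nhds, fun _ => hr⟩
  constructor
  -- As `φ̂` is even, the inequality for `d` at `t` or at `-t`, whichever makes the linear term
  -- nonnegative, yields the one for zero.
  · intro d hd
    refine h0 ⟨hd.1, hd.2.1, fun ε hε => ?_⟩
    have h1 := hd.2.2 ε hε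
    have h2 := (continuous_neg.tendsto' (0 : ℝ) 0 neg_zero).eventually h1
    filter_upwards [h1, h2] with t h1 h2
    have h3 : phiHat φ (-t) = phiHat φ t := by rw [phiHat, phiHat, abs_neg]
    rw [h3] at h2
    rw [hφ0] at h1 h2 ⊢
    rcases le_total 0 (t * d) with h4 | h4
    · refine le_trans ?_ h1
      rw [← EReal.coe_add, ← EReal.coe_add, EReal.coe_le_coe_iff]
      simp
      linarith
    · refine le_trans ?_ h2
      rw [← EReal.coe_add, ← EReal.coe_add, EReal.coe_le_coe_iff]
      simp
      linarith
  -- Failure at zero produces one point with `φ |t| < φ 0 - ε |t|`. By continuity the secant slope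
  -- from nearby `ω` to `|t|` stays below `-ε`, and it bounds the subgradients at `ω > 0`.
  · have h1 : ∃ ε : ℝ, 0 < ε ∧ ∃ᶠ t : ℝ in nhds 0,
        phiHat φ t < phiHat φ 0 + ((inner ℝ (0 : ℝ) (t - 0) - ε * ‖t - 0‖ : ℝ) : EReal) := by
      by_contra! h2
      refine h0 ⟨?_, ?_, fun ε hε => ?_⟩
      · rw [hφ0]; exact EReal.coe_ne_bot _
      · rw [hφ0]; exact EReal.coe_ne_top _
      · exact h2 ε hε
    obtain ⟨ε, hε, h1⟩ := h1
    obtain ⟨t, ht1, ht2⟩ := (h1.and_eventually (Ioo_mem_nhds (neg_lt_zero.2 hδ) hδ)).exists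
    have ht3 : |t| ∈ Set.Ioo (-δ) (1 + δ) :=
      ⟨by linarith [abs_nonneg t], by linarith [abs_lt.2 ht2]⟩
    rw [hφ0, phiHat, hfin _ ht3, ← EReal.coe_add, EReal.coe_lt_coe_iff, inner_zero_left, sub_zero,
      zero_sub, Real.norm_eq_abs] at ht1
    have ht0 : 0 < |t| := by
      rcases eq_or_ne t 0 with rfl | h
      · simp at ht1
      · exact abs_pos.2 h
    have hcont : ContinuousAt (fun s => (φ s).toReal) 0 :=
      (hcv.continuousOn isOpen_Ioo).continuousAt (isOpen_Ioo.mem_nhds h0I)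
    have hlim : Filter.Tendsto (fun ω : ℝ => (φ ω).toReal - ε * (|t| - ω)) (nhds 0)
        (nhds ((φ 0).toReal - ε * (|t| - 0))) :=
      hcont.sub (tendsto_const_nhds.mul (tendsto_const_nhds.sub Filter.tendsto_id))
    refine ⟨ε, hε, ?_⟩
    filter_upwards [hlim.eventually (lt_mem_nhds (a := (φ |t|).toReal) (by linarith)),
      isOpen_Ioo.mem_nhds h0I, gt_mem_nhds ht0] with ω h2 h3 h4 h5 d hd
    have h6 := add_mul_le_of_mem_regularSubdiff_phiHat hfin hcv h5 h3 hd ht3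
    by_contra! h7
    nlinarith

/-! ### Limiting subgradients of the spectral function on singular subspaces. -/

theorem abs_dotProduct_mulVec_le {m : ℕ} (P : Matrix (Fin m) (Fin m) ℝ) (y : Fin m → ℝ) :
    |y ⬝ᵥ P *ᵥ y| ≤ ‖P‖ * (y ⬝ᵥ y) := by
  rw [abs_le]
  have h1 := dotProduct_mulVec_le (-P) y
  rw [neg_mulVec, dotProduct_neg, norm_neg] at h1
  exact ⟨by linarith, dotProduct_mulVec_le P y⟩

/-- The quadratic form of `Wᵀ D`, for a regular subgradient `D`, is close to its expected value near
the eigenspace of `Wᵀ W` for `s²`. -/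
theorem quadratic_estimate_of_mem_regularSubdiff {m n : ℕ} (hmn : m ≤ n) {φ : ℝ → EReal}
    (hφ : ∀ t, φ t ≠ ⊥) {W D : Matrix (Fin m) (Fin n) ℝ}
    (hD : D ∈ regularSubdiff (phiHatSv φ) W) {s δ ε κ K τ : ℝ} (hs : 0 < s) (hδ : 0 < δ)
    (hε : 0 < ε) (hτ : |τ| = 1) (hK : ‖Wᵀ * D‖ ≤ K)
    (h : ∀ ω, |ω - s| < δ → 0 < ω ∧ ∀ d ∈ regularSubdiff (phiHat φ) ω, |ω * d - κ| ≤ ε)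
    (y : Fin n → ℝ) :
    0 ≤ ε * (y ⬝ᵥ y) + τ * ((W *ᵥ y) ⬝ᵥ (D *ᵥ y) - κ * (y ⬝ᵥ y)) +
      (K + |κ|) / (δ * s) ^ 2 *
        ((s ^ 2 • y - Wᵀ *ᵥ (W *ᵥ y)) ⬝ᵥ (s ^ 2 • y - Wᵀ *ᵥ (W *ᵥ y))) := by
  obtain ⟨A, hA⟩ : ∃ A, A = Wᵀ * W := ⟨_, rfl⟩
  obtain ⟨B, hB⟩ : ∃ B, B = Wᵀ * D := ⟨_, rfl⟩
  obtain ⟨C, hC⟩ : ∃ C, C = (K + |κ|) / (δ * s) ^ 2 := ⟨_, rfl⟩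
  obtain ⟨G, hG⟩ : ∃ G : Matrix (Fin n) (Fin n) ℝ, G = s ^ 2 • 1 - A := ⟨_, rfl⟩
  have hC0 : 0 ≤ C := by
    rw [hC]
    have : 0 ≤ K := (norm_nonneg _).trans hK
    positivity
  have hAt : Aᵀ = A := by rw [hA, transpose_mul, transpose_transpose]
  have hBt : Bᵀ = B := by rw [hB, transpose_mul_symm_of_mem_regularSubdiff hmn hD]
  have hGt : Gᵀ = G := by rw [hG, transpose_sub, hAt, transpose_smul, transpose_one]
  have hAB : A * B = B * A := by
    have h1 : W * Dᵀ = D * Wᵀ := by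
      rw [← mul_transpose_symm_of_mem_regularSubdiff hmn hD, transpose_mul, transpose_transpose]
    have h2 : Dᵀ * W = Wᵀ * D := by
      rw [← transpose_mul_symm_of_mem_regularSubdiff hmn hD, transpose_mul, transpose_transpose]
    rw [hA, hB, Matrix.mul_assoc Wᵀ D, ← Matrix.mul_assoc D, ← h1, Matrix.mul_assoc W, h2,
      Matrix.mul_assoc]
  have hAG : A * G = G * A := by
    rw [hG, Matrix.mul_sub, Matrix.sub_mul]
    simp
  -- `N` commutes with `A = Wᵀ W`, so only eigenvectors of `A` need checking. For `ω` near `s` the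
  -- singular pair gives a form of `B` within `ε` of `κ`; for `|ω - s| ≥ δ` the penalty is at least
  -- `C (δ s)² = K + |κ|`, which absorbs the rest.
  obtain ⟨N, hN⟩ : ∃ N, N = ε • (1 : Matrix (Fin n) (Fin n) ℝ) + τ • (B - κ • 1) + C • (G * G) :=
    ⟨_, rfl⟩
  have hform : ∀ x, x ⬝ᵥ N *ᵥ x = ε * (x ⬝ᵥ x) + τ * (x ⬝ᵥ B *ᵥ x - κ * (x ⬝ᵥ x)) +
      C * ((G *ᵥ x) ⬝ᵥ (G *ᵥ x)) := by
    intro x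
    rw [hN]
    simp only [add_mulVec, smul_mulVec, sub_mulVec, one_mulVec, dotProduct_add, dotProduct_smul,
      dotProduct_sub, smul_eq_mul, ← mulVec_mulVec]
    rw [dotProduct_mulVec_eq G, hGt]
  have hfin := dotProduct_mulVec_nonneg_of_commute (A := A) (N := N) hAt
    (by rw [hN]; simp [hBt, hGt])
    (by
      rw [hN]
      simp only [Matrix.mul_add, Matrix.add_mul, Matrix.mul_smul, Matrix.smul_mul, Matrix.mul_sub,
        Matrix.sub_mul, Matrix.mul_one, Matrix.one_mul, hAB, Matrix.mul_assoc]
      rw [← Matrix.mul_assoc A, hAG, Matrix.mul_assoc G A, hAG])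
    (by
      intro v l hv hl
      rw [hform, hv]
      have hGv : G *ᵥ v = (s ^ 2 - l) • v := by
        rw [hG, sub_mulVec, hl, smul_mulVec, one_mulVec, sub_smul]
      rw [hGv, smul_dotProduct, dotProduct_smul, hv]
      simp only [smul_eq_mul, mul_one]
      have hl' : (W *ᵥ v) ⬝ᵥ (W *ᵥ v) = l := by
        have : v ⬝ᵥ A *ᵥ v = l := by rw [hl, dotProduct_smul, hv, smul_eq_mul, mul_one]
        rwa [hA, ← mulVec_mulVec, dotProduct_mulVec_eq, transpose_transpose] at this
      have hl0 : 0 ≤ l := hl' ▸ dotProduct_self_nonneg' _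
      obtain ⟨ω, hω0, rfl⟩ : ∃ ω, 0 ≤ ω ∧ l = ω ^ 2 := ⟨√l, Real.sqrt_nonneg _, (Real.sq_sqrt hl0).symm⟩
      rcases lt_or_ge |ω - s| δ with h1 | h1
      · obtain ⟨hω, h2⟩ := h ω h1
        have h3 := mem_regularSubdiff_phiHat hmn hφ hD (u := ω⁻¹ • (W *ᵥ v)) (v := v) (ω := ω)
          (by rw [smul_dotProduct, dotProduct_smul, hl']; simp only [smul_eq_mul]; field_simp) hv
          (by rw [smul_smul, mul_inv_cancel₀ hω.ne', one_smul])
          (by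
            rw [mulVec_smul, mulVec_mulVec, ← hA, hl, smul_smul]
            congr 1
            field_simp)
        have h4 := h2 _ h3
        rw [smul_dotProduct, smul_eq_mul, ← mul_assoc, mul_inv_cancel₀ hω.ne', one_mul] at h4
        have h5 : v ⬝ᵥ B *ᵥ v = (W *ᵥ v) ⬝ᵥ D *ᵥ v := by
          rw [hB, ← mulVec_mulVec, dotProduct_mulVec_eq, transpose_transpose]
        rw [← h5] at h4
        have h6 : |τ * (v ⬝ᵥ B *ᵥ v - κ)| ≤ ε := by rw [abs_mul, hτ, one_mul]; exact h4
        have h7 := (abs_le.1 h6).1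
        have h8 := mul_nonneg hC0 (mul_self_nonneg (s ^ 2 - ω ^ 2))
        linarith
      · have h2 : (δ * s) ^ 2 ≤ (s ^ 2 - ω ^ 2) * (s ^ 2 - ω ^ 2) := by
          have h3 : |s ^ 2 - ω ^ 2| = |ω - s| * (s + ω) := by
            rw [← abs_of_nonneg (add_nonneg hs.le hω0), ← abs_mul, ← abs_neg]
            congr 1
            ring
          rw [← abs_mul_abs_self, h3, pow_two]
          have : δ * s ≤ |ω - s| * (s + ω) :=
            mul_le_mul h1 (by linarith) hs.le (abs_nonneg _)
          exact mul_self_le_mul_self (by positivity) this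
        have h3 : K + |κ| ≤ C * ((s ^ 2 - ω ^ 2) * (s ^ 2 - ω ^ 2)) := by
          calc K + |κ| = C * (δ * s) ^ 2 := by rw [hC]; field_simp
            _ ≤ _ := mul_le_mul_of_nonneg_left h2 hC0
        have h4 := abs_dotProduct_mulVec_le B v
        rw [hv, mul_one] at h4
        have h5 : |τ * (v ⬝ᵥ B *ᵥ v - κ)| ≤ K + |κ| := by
          rw [abs_mul, hτ, one_mul]
          exact (abs_sub _ _).trans (add_le_add (h4.trans (hB ▸ hK)) le_rfl)
        have h6 := (abs_le.1 h5).1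
        linarith)
    y
  rw [hform, hG, hB, sub_mulVec, smul_mulVec, one_mulVec, hA, ← mulVec_mulVec, ← mulVec_mulVec,
    dotProduct_mulVec_eq, transpose_transpose, hC] at hfin
  exact hfin

/-- On a singular pair of value `ω` the form of `Wᵀ D` is `ω d`, not `d`; hence the product. -/
theorem IsL1.eventually_abs_mul_sub_le {φ : ℝ → EReal} (hφ : IsL1 φ) {s : ℝ}
    (hs : s ∈ Set.Ioc (0 : ℝ) 1) {ε : ℝ} (hε : 0 < ε) :
    ∀ᶠ ω in nhds s, ∀ d ∈ regularSubdiff (phiHat φ) ω,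
      |ω * d - s * deriv (fun s => (φ s).toReal) s| ≤ ε := by
  set p := deriv (fun s => (φ s).toReal) s
  have hc : Continuous fun ω : ℝ => |ω - s| * |p| := by fun_prop
  filter_upwards [hφ.eventually_abs_sub_deriv_le hs (show 0 < ε / 4 by positivity),
    (hc.tendsto' s 0 (by simp)).eventually (gt_mem_nhds (show 0 < ε / 2 by positivity)),
    Ioo_mem_nhds hs.1 (show s < 2 by linarith [hs.2])] with ω h1 h2 h3 d hd
  have h4 := h1 d hd
  have h5 : ω * d - s * p = ω * (d - p) + (ω - s) * p := by ring
  rw [h5]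
  refine (abs_add_le _ _).trans ?_
  rw [abs_mul, abs_mul, abs_of_pos h3.1]
  have := mul_le_mul h3.2.le h4 (abs_nonneg _) zero_le_two
  linarith

/-- Limiting subgradients of the spectral function on an eigenspace of `Wᵀ W`. -/
theorem IsL1.dotProduct_eq_of_mem_subdiff {m n : ℕ} (hmn : m ≤ n) {φ : ℝ → EReal} (hφ : IsL1 φ)
    {W D : Matrix (Fin m) (Fin n) ℝ} (hD : D ∈ subdiff (phiHatSv φ) W) {s : ℝ}
    (hs : s ∈ Set.Ioc (0 : ℝ) 1) {y : Fin n → ℝ} (hy : Wᵀ *ᵥ (W *ᵥ y) = s ^ 2 • y) :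
    (W *ᵥ y) ⬝ᵥ (D *ᵥ y) = s * deriv (fun s => (φ s).toReal) s * (y ⬝ᵥ y) := by
  obtain ⟨-, -, Ws, Ds, hWs, -, hDs, hr⟩ := hD
  set κ := s * deriv (fun s => (φ s).toReal) s with hκ
  have key : ∀ τ : ℝ, |τ| = 1 → 0 ≤ τ * ((W *ᵥ y) ⬝ᵥ (D *ᵥ y) - κ * (y ⬝ᵥ y)) := by
    intro τ hτ
    refine le_of_forall_pos_le_add_mul (c := y ⬝ᵥ y) fun ε hε => ?_
    obtain ⟨δ, hδ, h⟩ := Metric.eventually_nhds_iff.1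
      ((lt_mem_nhds hs.1).and (hφ.eventually_abs_mul_sub_le hs hε))
    have hb : ∀ᶠ k in Filter.atTop, ‖(Ws k)ᵀ * Ds k‖ ≤ ‖Wᵀ * D‖ + 1 := by
      have hc : Continuous fun p : Matrix (Fin m) (Fin n) ℝ × Matrix (Fin m) (Fin n) ℝ =>
          ‖p.1ᵀ * p.2‖ := by fun_prop
      have := (hc.tendsto (W, D)).comp (hWs.prodMk_nhds hDs)
      exact (this.eventually (gt_mem_nhds (lt_add_one _))).mono fun k hk => hk.le
    have hc : Continuous fun p : Matrix (Fin m) (Fin n) ℝ × Matrix (Fin m) (Fin n) ℝ =>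
        ε * (y ⬝ᵥ y) + τ * ((p.1 *ᵥ y) ⬝ᵥ (p.2 *ᵥ y) - κ * (y ⬝ᵥ y)) +
        (‖Wᵀ * D‖ + 1 + |κ|) / (δ * s) ^ 2 *
        ((s ^ 2 • y - p.1ᵀ *ᵥ (p.1 *ᵥ y)) ⬝ᵥ (s ^ 2 • y - p.1ᵀ *ᵥ (p.1 *ᵥ y))) := by fun_prop
    have h1 := ge_of_tendsto ((hc.tendsto (W, D)).comp (hWs.prodMk_nhds hDs)) (hb.mono fun k hk =>
      quadratic_estimate_of_mem_regularSubdiff hmn hφ.ne_bot (hr k) hs.1 hδ hε hτ hk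
        (fun ω hω => h hω) y)
    -- The estimate was stated for fixed `y`, so no convergence of eigenvectors is needed: the
    -- penalty disappears in the limit because `y` is an exact eigenvector there.
    simp only [hy, sub_self, zero_dotProduct, mul_zero, add_zero] at h1
    linarith
  linarith [key 1 (by simp), key (-1) (by simp)]

/-- Completes a left null vector to a singular pair of value zero. An injective `W` would have `m =
n`, hence be surjective, contradicting the left kernel. -/
theorem exists_unit_mulVec_eq_zero {m n : ℕ} (hmn : m ≤ n) {W : Matrix (Fin m) (Fin n) ℝ}
    {u : Fin m → ℝ} (hu : u ⬝ᵥ u = 1) (h : Wᵀ *ᵥ u = 0) :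
    ∃ v : Fin n → ℝ, v ⬝ᵥ v = 1 ∧ W *ᵥ v = 0 := by
  have hni : ¬ Function.Injective W.mulVecLin := by
    intro hi
    have h1 := LinearMap.finrank_le_finrank_of_injective hi
    rw [Module.finrank_fin_fun, Module.finrank_fin_fun] at h1
    obtain ⟨x, hx⟩ := (LinearMap.injective_iff_surjective_of_finrank_eq_finrank (by
      rw [Module.finrank_fin_fun, Module.finrank_fin_fun]; omega)).1 hi u
    rw [mulVecLin_apply] at hx
    rw [← hx, ← transpose_transpose W, ← dotProduct_mulVec_eq, transpose_transpose, hx, h] at hu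
    simp at hu
  rw [← LinearMap.ker_eq_bot, Submodule.eq_bot_iff] at hni
  push Not at hni
  obtain ⟨v, hv, hv0⟩ := hni
  rw [LinearMap.mem_ker, mulVecLin_apply] at hv
  have hvv : 0 < v ⬝ᵥ v := by simpa using dotProduct_star_self_pos_iff.2 hv0
  refine ⟨(√(v ⬝ᵥ v))⁻¹ • v, ?_, by rw [mulVec_smul, hv, smul_zero]⟩
  rw [smul_dotProduct, dotProduct_smul, smul_smul, ← mul_inv, Real.mul_self_sqrt hvv.le,
      smul_eq_mul, inv_mul_cancel₀ hvv.ne']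

/-- The left quadratic form of a regular subgradient near the left kernel of `W`. -/
theorem kernel_estimate_of_mem_regularSubdiff {m n : ℕ} (hmn : m ≤ n) {φ : ℝ → EReal}
    (hφ : ∀ t, φ t ≠ ⊥) {W D : Matrix (Fin m) (Fin n) ℝ}
    (hD : D ∈ regularSubdiff (phiHatSv φ) W) {δ c : ℝ} (hδ : 0 < δ) (hc : 0 < c)
    (h0 : ∀ d, d ∉ regularSubdiff (phiHat φ) 0)
    (h : ∀ ω, 0 < ω → ω < δ → ∀ d ∈ regularSubdiff (phiHat φ) ω, d ≤ -c) (y : Fin m → ℝ) :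
    0 ≤ (Dᵀ *ᵥ y) ⬝ᵥ (Dᵀ *ᵥ y) - c ^ 2 * (y ⬝ᵥ y) +
      c ^ 2 / δ ^ 2 * ((Wᵀ *ᵥ y) ⬝ᵥ (Wᵀ *ᵥ y)) := by
  obtain ⟨A, hA⟩ : ∃ A, A = W * Wᵀ := ⟨_, rfl⟩
  obtain ⟨N, hN⟩ : ∃ N, N = D * Dᵀ - c ^ 2 • (1 : Matrix (Fin m) (Fin m) ℝ) + (c ^ 2 / δ ^ 2) • A :=
    ⟨_, rfl⟩
  have hAt : Aᵀ = A := by rw [hA, transpose_mul, transpose_transpose]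
  have hAD : A * (D * Dᵀ) = D * Dᵀ * A := by
    have h1 : W * Dᵀ = D * Wᵀ := by
      rw [← mul_transpose_symm_of_mem_regularSubdiff hmn hD, transpose_mul, transpose_transpose]
    have h2 : Dᵀ * W = Wᵀ * D := by
      rw [← transpose_mul_symm_of_mem_regularSubdiff hmn hD, transpose_mul, transpose_transpose]
    calc A * (D * Dᵀ) = W * (Wᵀ * D) * Dᵀ := by rw [hA]; simp only [Matrix.mul_assoc]
      _ = (W * Dᵀ) * (W * Dᵀ) := by rw [← h2]; simp only [Matrix.mul_assoc]
      _ = D * (Wᵀ * D) * Wᵀ := by rw [h1]; simp only [Matrix.mul_assoc]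
      _ = D * Dᵀ * A := by rw [← h2, hA]; simp only [Matrix.mul_assoc]
  have hform : ∀ x, x ⬝ᵥ N *ᵥ x = (Dᵀ *ᵥ x) ⬝ᵥ (Dᵀ *ᵥ x) - c ^ 2 * (x ⬝ᵥ x) +
      c ^ 2 / δ ^ 2 * ((Wᵀ *ᵥ x) ⬝ᵥ (Wᵀ *ᵥ x)) := by
    intro x
    rw [hN, hA]
    simp only [add_mulVec, smul_mulVec, sub_mulVec, one_mulVec, dotProduct_add, dotProduct_smul,
      dotProduct_sub, smul_eq_mul, ← mulVec_mulVec]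
    rw [dotProduct_mulVec_eq D, dotProduct_mulVec_eq W]
  rw [← hform]
  refine dotProduct_mulVec_nonneg_of_commute (A := A) hAt (by rw [hN]; simp [hAt]) ?_ ?_ y
  · rw [hN]
    simp only [Matrix.mul_add, Matrix.add_mul, Matrix.mul_smul, Matrix.smul_mul, Matrix.mul_sub,
      Matrix.sub_mul, Matrix.mul_one, Matrix.one_mul, hAD]
  · intro u l hu hl
    rw [hform, hu]
    have hl' : (Wᵀ *ᵥ u) ⬝ᵥ (Wᵀ *ᵥ u) = l := by
      have : u ⬝ᵥ A *ᵥ u = l := by rw [hl, dotProduct_smul, hu, smul_eq_mul, mul_one]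
      rwa [hA, ← mulVec_mulVec, dotProduct_mulVec_eq] at this
    have hl0 : 0 ≤ l := hl' ▸ dotProduct_self_nonneg' _
    obtain ⟨ω, hω0, rfl⟩ : ∃ ω, 0 ≤ ω ∧ l = ω ^ 2 := ⟨√l, Real.sqrt_nonneg _, (Real.sq_sqrt hl0).symm⟩
    rw [hl']
    -- The case `ω = 0` cannot occur, since it would give a regular subgradient of `φ̂` at zero. For
    -- `ω < δ` the pair forces `|Dᵀ u| ≥ c`; for `ω ≥ δ` the penalty alone reaches `c²`.
    rcases eq_or_lt_of_le hω0 with rfl | hω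
    · have h1 : Wᵀ *ᵥ u = 0 := dotProduct_self_eq_zero.1 (by rw [hl']; simp)
      obtain ⟨v, hv, hv0⟩ := exists_unit_mulVec_eq_zero hmn hu h1
      exact absurd (mem_regularSubdiff_phiHat hmn hφ hD (ω := 0) hu hv (by simp [hv0]) (by simp [h1]))
        (h0 _)
    rcases lt_or_ge ω δ with h1 | h1
    · have hvv : (ω⁻¹ • (Wᵀ *ᵥ u)) ⬝ᵥ (ω⁻¹ • (Wᵀ *ᵥ u)) = 1 := by
        rw [smul_dotProduct, dotProduct_smul, hl']; simp only [smul_eq_mul]; field_simp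
      have h2 := h ω hω h1 _ (mem_regularSubdiff_phiHat hmn hφ hD (v := ω⁻¹ • (Wᵀ *ᵥ u)) hu hvv
        (by
            rw [mulVec_smul, mulVec_mulVec, ← hA, hl, smul_smul]
            congr 1
            field_simp)
        (by rw [smul_smul, mul_inv_cancel₀ hω.ne', one_smul]))
      rw [dotProduct_mulVec_eq] at h2
      have h3 := sq_dotProduct_le (Dᵀ *ᵥ u) (ω⁻¹ • (Wᵀ *ᵥ u))
      rw [hvv, mul_one] at h3
      have h4 : 0 ≤ c ^ 2 / δ ^ 2 * ω ^ 2 := by positivity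
      nlinarith
    · have h2 : c ^ 2 ≤ c ^ 2 / δ ^ 2 * ω ^ 2 := by
        rw [div_mul_eq_mul_div, le_div_iff₀ (by positivity)]
        gcongr
      linarith [dotProduct_self_nonneg' (Dᵀ *ᵥ u)]

/-- In the limit the kernel estimate at such a vector reads `0 ≤ -c² |a|²`. -/
theorem IsL.eq_zero_of_mem_subdiff {m n : ℕ} (hmn : m ≤ n) {φ : ℝ → EReal} (hφ : IsL φ)
    (h0 : (0 : ℝ) ∉ subdiff (phiHat φ) 0)
    {W D : Matrix (Fin m) (Fin n) ℝ} (hD : D ∈ subdiff (phiHatSv φ) W) {a : Fin m → ℝ}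
    (hW : Wᵀ *ᵥ a = 0) (hDa : Dᵀ *ᵥ a = 0) : a = 0 := by
  obtain ⟨-, -, Ws, Ds, hWs, -, hDs, hr⟩ := hD
  obtain ⟨h1, c, hc, h2⟩ := hφ.exists_le_neg_of_zero_notMem_subdiff h0
  obtain ⟨δ, hδ, h⟩ := Metric.eventually_nhds_iff.1 h2
  have hcont : Continuous fun p : Matrix (Fin m) (Fin n) ℝ × Matrix (Fin m) (Fin n) ℝ =>
      (p.2ᵀ *ᵥ a) ⬝ᵥ (p.2ᵀ *ᵥ a) - c ^ 2 * (a ⬝ᵥ a) +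
      c ^ 2 / δ ^ 2 * ((p.1ᵀ *ᵥ a) ⬝ᵥ (p.1ᵀ *ᵥ a)) := by fun_prop
  have h3 := ge_of_tendsto' ((hcont.tendsto (W, D)).comp (hWs.prodMk_nhds hDs)) fun k =>
    kernel_estimate_of_mem_regularSubdiff hmn hφ.ne_bot (hr k) hδ hc h1
      (fun ω hω hωδ => h (by rwa [Real.dist_eq, sub_zero, abs_of_pos hω]) hω) a
  simp only [hW, hDa, zero_dotProduct, mul_zero, add_zero, zero_sub] at h3
  rw [← dotProduct_self_eq_zero]
  refine le_antisymm ?_ (dotProduct_self_nonneg' a)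
  have : 0 < c ^ 2 := by positivity
  nlinarith

theorem mul_transpose_symm_of_mem_subdiff {m n : ℕ} (hmn : m ≤ n) {φ : ℝ → EReal}
    {W D : Matrix (Fin m) (Fin n) ℝ} (hD : D ∈ subdiff (phiHatSv φ) W) :
    (D * Wᵀ)ᵀ = D * Wᵀ := by
  obtain ⟨-, -, Ws, Ds, hWs, -, hDs, hr⟩ := hD
  have hc : Continuous fun p : Matrix (Fin m) (Fin n) ℝ × Matrix (Fin m) (Fin n) ℝ =>
      (p.2 * p.1ᵀ)ᵀ - p.2 * p.1ᵀ := by fun_prop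
  have h1 := (hc.tendsto (W, D)).comp (hWs.prodMk_nhds hDs)
  have h2 : ∀ k, (Ds k * (Ws k)ᵀ)ᵀ - Ds k * (Ws k)ᵀ = 0 := fun k =>
    sub_eq_zero.2 (mul_transpose_symm_of_mem_regularSubdiff hmn (hr k))
  exact sub_eq_zero.1 (tendsto_nhds_unique (h1.congr h2) tendsto_const_nhds)

theorem transpose_mul_symm_of_mem_subdiff {m n : ℕ} (hmn : m ≤ n) {φ : ℝ → EReal}
    {W D : Matrix (Fin m) (Fin n) ℝ} (hD : D ∈ subdiff (phiHatSv φ) W) :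
    (Wᵀ * D)ᵀ = Wᵀ * D := by
  obtain ⟨-, -, Ws, Ds, hWs, -, hDs, hr⟩ := hD
  have hc : Continuous fun p : Matrix (Fin m) (Fin n) ℝ × Matrix (Fin m) (Fin n) ℝ =>
      (p.1ᵀ * p.2)ᵀ - p.1ᵀ * p.2 := by fun_prop
  have h1 := (hc.tendsto (W, D)).comp (hWs.prodMk_nhds hDs)
  have h2 : ∀ k, ((Ws k)ᵀ * Ds k)ᵀ - (Ws k)ᵀ * Ds k = 0 := fun k =>
    sub_eq_zero.2 (transpose_mul_symm_of_mem_regularSubdiff hmn (hr k))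
  exact sub_eq_zero.1 (tendsto_nhds_unique (h1.congr h2) tendsto_const_nhds)

/-! ### Limiting normals to the graph. -/

theorem eq_zero_of_forall_mulVec_eq_zero {m n : ℕ} {M : Matrix (Fin m) (Fin n) ℝ}
    (h : ∀ z, M *ᵥ z = 0) : M = 0 := by
  ext i j
  simpa using congrFun (h (Pi.single j 1)) i

/-- Orthogonal splitting along the range of `Xᵀ` and the kernel of `X`: the equation `X Xᵀ z = X y`
is solvable because `X Xᵀ` and `X` have the same range. -/
theorem exists_transpose_mulVec_add {m n : ℕ} (X : Matrix (Fin m) (Fin n) ℝ) (y : Fin n → ℝ) :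
    ∃ z p, y = Xᵀ *ᵥ z + p ∧ X *ᵥ p = 0 ∧ p ⬝ᵥ p ≤ y ⬝ᵥ y := by
  obtain ⟨z, hz⟩ : ∃ z, X *ᵥ (Xᵀ *ᵥ z) = X *ᵥ y := by
    have h1 := (toEuclideanLin Xᵀ).range_adjoint_comp_self
    rw [← toEuclideanLin_conjTranspose_eq_adjoint, conjTranspose_eq_transpose_of_trivial,
      transpose_transpose] at h1
    have h2 : toEuclideanLin X (WithLp.toLp 2 y) ∈ (toEuclideanLin X).range := ⟨_, rfl⟩
    rw [← h1] at h2
    obtain ⟨z, hz⟩ := h2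
    exact ⟨WithLp.ofLp z, by simpa using congrArg WithLp.ofLp hz⟩
  have hp : X *ᵥ (y - Xᵀ *ᵥ z) = 0 := by rw [mulVec_sub, hz, sub_self]
  refine ⟨z, y - Xᵀ *ᵥ z, by abel, hp, ?_⟩
  obtain ⟨p, hp'⟩ : ∃ p, p = y - Xᵀ *ᵥ z := ⟨_, rfl⟩
  rw [← hp'] at hp ⊢
  have hy : y = Xᵀ *ᵥ z + p := by rw [hp']; abel
  have h3 : (Xᵀ *ᵥ z) ⬝ᵥ p = 0 := by rw [← dotProduct_mulVec_eq, hp, dotProduct_zero]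
  rw [hy, add_dotProduct, dotProduct_add, dotProduct_add, dotProduct_comm p (Xᵀ *ᵥ z), h3]
  linarith [dotProduct_self_nonneg' (Xᵀ *ᵥ z)]

section LimitingNormal

variable {m n : ℕ} {u v X W : Matrix (Fin m) (Fin n) ℝ}

theorem normal_left_symm (hmn : m ≤ n)
    (hN : WithLp.toLp 2 (u, v) ∈ normalCone (gph nuclearSubdiff) (WithLp.toLp 2 (X, W))) :
    (u * Xᵀ + v * Wᵀ)ᵀ = u * Xᵀ + v * Wᵀ := by
  obtain ⟨us, vs, Xs, Ws, hu, hv, hX, hW, hP, hr⟩ := exists_seq_of_mem_normalCone hmn hN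
  have hc : Continuous fun p : (Matrix (Fin m) (Fin n) ℝ × Matrix (Fin m) (Fin n) ℝ) ×
      (Matrix (Fin m) (Fin n) ℝ × Matrix (Fin m) (Fin n) ℝ) =>
      (p.1.1 * p.2.1ᵀ + p.1.2 * p.2.2ᵀ)ᵀ - (p.1.1 * p.2.1ᵀ + p.1.2 * p.2.2ᵀ) := by fun_prop
  have h1 := (hc.tendsto ((u, v), (X, W))).comp ((hu.prodMk_nhds hv).prodMk_nhds (hX.prodMk_nhds hW))
  exact sub_eq_zero.1 (tendsto_nhds_unique (h1.congr fun k =>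
    sub_eq_zero.2 (regularNormal_left_symm hmn (hP k) (hr k))) tendsto_const_nhds)

theorem normal_right_symm (hmn : m ≤ n)
    (hN : WithLp.toLp 2 (u, v) ∈ normalCone (gph nuclearSubdiff) (WithLp.toLp 2 (X, W))) :
    (Xᵀ * u + Wᵀ * v)ᵀ = Xᵀ * u + Wᵀ * v := by
  obtain ⟨us, vs, Xs, Ws, hu, hv, hX, hW, hP, hr⟩ := exists_seq_of_mem_normalCone hmn hN
  have hc : Continuous fun p : (Matrix (Fin m) (Fin n) ℝ × Matrix (Fin m) (Fin n) ℝ) ×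
      (Matrix (Fin m) (Fin n) ℝ × Matrix (Fin m) (Fin n) ℝ) =>
      (p.2.1ᵀ * p.1.1 + p.2.2ᵀ * p.1.2)ᵀ - (p.2.1ᵀ * p.1.1 + p.2.2ᵀ * p.1.2) := by fun_prop
  have h1 := (hc.tendsto ((u, v), (X, W))).comp ((hu.prodMk_nhds hv).prodMk_nhds (hX.prodMk_nhds hW))
  exact sub_eq_zero.1 (tendsto_nhds_unique (h1.congr fun k =>
    sub_eq_zero.2 (regularNormal_right_symm hmn (hP k) (hr k))) tendsto_const_nhds)

theorem normal_mul_mul_eq_zero (hmn : m ≤ n)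
    (hN : WithLp.toLp 2 (u, v) ∈ normalCone (gph nuclearSubdiff) (WithLp.toLp 2 (X, W))) :
    (1 - W * Wᵀ) * v * (1 - Wᵀ * W) = 0 := by
  obtain ⟨us, vs, Xs, Ws, hu, hv, hX, hW, hP, hr⟩ := exists_seq_of_mem_normalCone hmn hN
  have hc : Continuous fun p : Matrix (Fin m) (Fin n) ℝ × Matrix (Fin m) (Fin n) ℝ =>
      (1 - p.2 * p.2ᵀ) * p.1 * (1 - p.2ᵀ * p.2) := by fun_prop
  have h1 := (hc.tendsto (v, W)).comp (hv.prodMk_nhds hW)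
  exact tendsto_nhds_unique (h1.congr fun k => regularNormal_mul_mul_eq_zero hmn (hP k) (hr k))
    tendsto_const_nhds

theorem normal_dotProduct_eq_zero (hmn : m ≤ n)
    (hN : WithLp.toLp 2 (u, v) ∈ normalCone (gph nuclearSubdiff) (WithLp.toLp 2 (X, W)))
    (z : Fin m → ℝ) : (W *ᵥ (Xᵀ *ᵥ z)) ⬝ᵥ (u *ᵥ (Xᵀ *ᵥ z)) = 0 := by
  obtain ⟨us, vs, Xs, Ws, hu, hv, hX, hW, hP, hr⟩ := exists_seq_of_mem_normalCone hmn hN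
  have hc : Continuous fun p : Matrix (Fin m) (Fin n) ℝ ×
      (Matrix (Fin m) (Fin n) ℝ × Matrix (Fin m) (Fin n) ℝ) =>
      (p.2.2 *ᵥ (p.2.1ᵀ *ᵥ z)) ⬝ᵥ (p.1 *ᵥ (p.2.1ᵀ *ᵥ z)) := by fun_prop
  have h1 := (hc.tendsto (u, (X, W))).comp (hu.prodMk_nhds (hX.prodMk_nhds hW))
  exact tendsto_nhds_unique (h1.congr fun k => regularNormal_dotProduct_eq_zero hmn (hP k) (hr k) z)
    tendsto_const_nhds

/-- If `v` is negative on the right singular vectors of `W` for the singular value one, then the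
quadratic form of `Wᵀ u` vanishes on them. -/
theorem normal_dotProduct_eq_zero_of_neg (hmn : m ≤ n)
    (hN : WithLp.toLp 2 (u, v) ∈ normalCone (gph nuclearSubdiff) (WithLp.toLp 2 (X, W)))
    (hneg : ∀ p, Wᵀ *ᵥ (W *ᵥ p) = p → 0 ≤ (W *ᵥ p) ⬝ᵥ (v *ᵥ p) → p = 0)
    {y : Fin n → ℝ} (hy : Wᵀ *ᵥ (W *ᵥ y) = y) : (W *ᵥ y) ⬝ᵥ (u *ᵥ y) = 0 := by
  obtain ⟨us, vs, Xs, Ws, hu, hv, hX, hW, hP, hr⟩ := exists_seq_of_mem_normalCone hmn hN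
  -- The two parts of `y` fall under different tests: the range part under the rank-one changes of
  -- `Xₖ`, the kernel part `pₖ` under the shrinking of `Wₖ`. Boundedness gives a limit `q` of the
  -- kernel parts along a subsequence.
  choose z p hzp hXp hpy using fun k => exists_transpose_mulVec_add (Xs k) y
  have hbd : ∀ k, p k ∈ Metric.closedBall (0 : Fin n → ℝ) √(y ⬝ᵥ y) := by
    intro k
    rw [mem_closedBall_zero_iff, pi_norm_le_iff_of_nonneg (Real.sqrt_nonneg _)]
    intro i
    rw [Real.norm_eq_abs]
    refine Real.abs_le_sqrt (le_trans ?_ (hpy k))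
    rw [pow_two]
    exact Finset.single_le_sum (f := fun i => p k i * p k i) (fun i _ => mul_self_nonneg _)
      (Finset.mem_univ i)
  obtain ⟨q, -, θ, hθ, hq⟩ := tendsto_subseq_of_bounded Metric.isBounded_closedBall hbd
  have hθ' := hθ.tendsto_atTop
  have hu := hu.comp hθ'
  have hv := hv.comp hθ'
  have hW := hW.comp hθ'
  have hyq : ∀ k, (Xs k)ᵀ *ᵥ z k = y - p k := fun k => eq_sub_of_add_eq (hzp k).symm
  -- `Wₖᵀ Wₖ` fixes the range of `Xₖᵀ`, hence `Wᵀ W` fixes `y - q`, and it fixes `y`. So `hneg`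
  -- applies to `q` and gives `q = 0`: the range parts converge to `y`.
  have hfix : Wᵀ *ᵥ (W *ᵥ q) = q := by
    have hc : Continuous fun r : Matrix (Fin m) (Fin n) ℝ × (Fin n → ℝ) =>
        r.1ᵀ *ᵥ (r.1 *ᵥ (y - r.2)) - (y - r.2) := by fun_prop
    have h1 := (hc.tendsto (W, q)).comp (hW.prodMk_nhds hq)
    have h2 : Wᵀ *ᵥ (W *ᵥ (y - q)) - (y - q) = 0 :=
      tendsto_nhds_unique (h1.congr fun k => by
        simp only [Function.comp_apply]
        rw [← hyq, sub_eq_zero, mulVec_mulVec, mulVec_mulVec]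
        congr 1
        conv_rhs => rw [← (hP (θ k)).mul_transpose_mul]
        rw [transpose_mul, transpose_mul, transpose_transpose, Matrix.mul_assoc]) tendsto_const_nhds
    rw [mulVec_sub, mulVec_sub, hy] at h2
    have : Wᵀ *ᵥ (W *ᵥ q) = q - (y - Wᵀ *ᵥ (W *ᵥ q) - (y - q)) := by abel
    rwa [h2, sub_zero] at this
  have hq0 : q = 0 := by
    refine hneg q hfix ?_
    have hc : Continuous fun r : (Matrix (Fin m) (Fin n) ℝ × Matrix (Fin m) (Fin n) ℝ) ×
        (Fin n → ℝ) => (r.1.1 *ᵥ r.2) ⬝ᵥ (r.1.2 *ᵥ r.2) := by fun_prop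
    have h1 := (hc.tendsto ((W, v), q)).comp ((hW.prodMk_nhds hv).prodMk_nhds hq)
    exact ge_of_tendsto' h1 fun k =>
      regularNormal_dotProduct_nonneg hmn (hP (θ k)) (hr (θ k)) (hXp (θ k))
  have hc : Continuous fun r : (Matrix (Fin m) (Fin n) ℝ × Matrix (Fin m) (Fin n) ℝ) ×
      (Fin n → ℝ) => (r.1.1 *ᵥ (y - r.2)) ⬝ᵥ (r.1.2 *ᵥ (y - r.2)) := by fun_prop
  have h1 := (hc.tendsto ((W, u), q)).comp ((hW.prodMk_nhds hu).prodMk_nhds hq)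
  have h2 := tendsto_nhds_unique (h1.congr fun k => by
    simp only [Function.comp_apply]
    rw [← hyq]
    exact regularNormal_dotProduct_eq_zero hmn (hP (θ k)) (hr (θ k)) _) tendsto_const_nhds
  simpa only [hq0, sub_zero] using h2

/-- `M = u Xᵀ` is symmetric and `R z ⬝ M z = 0` for `R = W Xᵀ`. At an eigenvector `y` of `M` with
nonzero eigenvalue this gives `y ⬝ R y = 0`, so `R y = 0` and `Xᵀ y = Wᵀ R y = 0`, whence `M y = 0`.
So every eigenvalue of `M` vanishes. -/
theorem normal_mul_transpose_eq_zero (hmn : m ≤ n) (hP : IsPolarPair X W)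
    (hN : WithLp.toLp 2 (u, v) ∈ normalCone (gph nuclearSubdiff) (WithLp.toLp 2 (X, W)))
    (hv : (v * Wᵀ)ᵀ = v * Wᵀ) : u * Xᵀ = 0 := by
  obtain ⟨M, hM⟩ : ∃ M, M = u * Xᵀ := ⟨_, rfl⟩
  obtain ⟨R, hR⟩ : ∃ R, R = W * Xᵀ := ⟨_, rfl⟩
  have hMt : Mᵀ = M := by
    have := normal_left_symm hmn hN
    rw [transpose_add, hv, add_left_inj] at this
    rw [hM, this]
  have hRt : Rᵀ = R := by rw [hR, transpose_mul, transpose_transpose, hP.symm]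
  have hRp : ∀ z, 0 ≤ z ⬝ᵥ R *ᵥ z := by rw [hR, hP.symm]; exact hP.nonneg
  have hRM : ∀ z, (R *ᵥ z) ⬝ᵥ (M *ᵥ z) = 0 := fun z => by
    have := normal_dotProduct_eq_zero hmn hN z
    rwa [mulVec_mulVec, mulVec_mulVec, ← hM, ← hR] at this
  have hXR : Xᵀ = Wᵀ * R := by
    conv_lhs => rw [← hP.mul_transpose_mul]
    rw [transpose_mul, transpose_mul, transpose_transpose, hR]
  have hev : ∀ (y : Fin m → ℝ) (l : ℝ), y ⬝ᵥ y = 1 → M *ᵥ y = l • y → l = 0 := by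
    intro y l hy hl
    by_contra hl0
    have h1 := hRM y
    rw [hl, dotProduct_smul, smul_eq_mul, mul_eq_zero, or_iff_right hl0, dotProduct_comm] at h1
    have h2 := sq_dotProduct_mulVec_le hRt hRp (R *ᵥ y) y
    rw [h1, mul_zero] at h2
    have h3 : R *ᵥ y = 0 := dotProduct_self_eq_zero.1 (pow_eq_zero_iff two_ne_zero |>.1
      (le_antisymm h2 (sq_nonneg _)))
    rw [hM, ← mulVec_mulVec, hXR, ← mulVec_mulVec, h3, mulVec_zero, mulVec_zero] at hl
    rcases smul_eq_zero.1 hl.symm with h4 | h4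
    · exact hl0 h4
    · simp [h4] at hy
  have h1 := dotProduct_mulVec_nonneg_of_commute (A := M) (N := M) hMt hMt rfl fun y l hy hl => by
    rw [hl, hev y l hy hl, zero_smul, dotProduct_zero]
  have h2 := dotProduct_mulVec_nonneg_of_commute (A := M) (N := -M) hMt (by rw [transpose_neg, hMt])
    (by simp) fun y l hy hl => by
    rw [neg_mulVec, hl, hev y l hy hl, zero_smul, neg_zero, dotProduct_zero]
  rw [← hM]
  refine eq_zero_of_forall_mulVec_eq_zero fun z => ?_
  have h3 := sq_dotProduct_mulVec_le hMt h1 (M *ᵥ z) z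
  have h4 : z ⬝ᵥ M *ᵥ z = 0 := by
    have := h2 z
    rw [neg_mulVec, dotProduct_neg] at this
    linarith [h1 z]
  rw [h4, mul_zero] at h3
  exact dotProduct_self_eq_zero.1 (pow_eq_zero_iff two_ne_zero |>.1 (le_antisymm h3 (sq_nonneg _)))

/-- The matrix `Xᵀ u` is symmetric with square `Xᵀ (u Xᵀ) u = 0`. -/
theorem normal_transpose_mul_eq_zero (hmn : m ≤ n) (hP : IsPolarPair X W)
    (hN : WithLp.toLp 2 (u, v) ∈ normalCone (gph nuclearSubdiff) (WithLp.toLp 2 (X, W)))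
    (hv : (v * Wᵀ)ᵀ = v * Wᵀ) (hv' : (Wᵀ * v)ᵀ = Wᵀ * v) : Xᵀ * u = 0 := by
  have h1 : (Xᵀ * u)ᵀ = Xᵀ * u := by
    have := normal_right_symm hmn hN
    rwa [transpose_add, hv', add_left_inj] at this
  refine conjTranspose_mul_self_eq_zero.1 ?_
  rw [conjTranspose_eq_transpose_of_trivial, h1, Matrix.mul_assoc, ← Matrix.mul_assoc u,
    normal_mul_transpose_eq_zero hmn hP hN hv, Matrix.zero_mul, Matrix.mul_zero]

end LimitingNormal

/-! ### Blocks of ΔΓ and emptiness of the index sets. -/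

theorem mulVec_col_of_mem_svdPairs {m n : ℕ} (hmn : m ≤ n) {Z : Matrix (Fin m) (Fin n) ℝ}
    {U : Matrix (Fin m) (Fin m) ℝ} {V : Matrix (Fin n) (Fin n) ℝ} (h : (U, V) ∈ svdPairs Z)
    (i : Fin m) : Z *ᵥ V.col (Fin.castLE hmn i) = sv Z i • U.col i ∧
      Zᵀ *ᵥ U.col i = sv Z i • V.col (Fin.castLE hmn i) := by
  obtain ⟨hU, hV, hZ⟩ := h
  have hU := transpose_mul_self_of_mem_orthogonalGroup hU
  have hV := transpose_mul_self_of_mem_orthogonalGroup hV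
  have h1 : Z * V = U * rectDiag n (sv Z) := by
    conv_lhs => rw [hZ]
    rw [Matrix.mul_assoc, hV, Matrix.mul_one]
  have h2 : Zᵀ * U = V * (rectDiag n (sv Z))ᵀ := by
    conv_lhs => rw [hZ]
    rw [transpose_mul, transpose_mul, transpose_transpose, Matrix.mul_assoc, Matrix.mul_assoc, hU,
      Matrix.mul_one]
  constructor
  · ext j
    have := congrFun (congrFun h1 j) (Fin.castLE hmn i)
    rw [mul_apply, mul_apply] at this
    refine Eq.trans (by rfl) (this.trans ?_)
    simp [rectDiag, ← Fin.ext_iff, mul_comm]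
  · ext j
    have := congrFun (congrFun h2 j) i
    rw [mul_apply, mul_apply] at this
    refine Eq.trans (by rfl) (this.trans ?_)
    rw [Finset.sum_eq_single (Fin.castLE hmn i)]
    · simp [rectDiag, mul_comm]
    · intro k _ hk
      have : (i : ℕ) ≠ (k : ℕ) := fun h => hk (Fin.ext h.symm)
      simp [rectDiag, this]
    · simp

section MStationary

variable {m n : ℕ} {X W D : Matrix (Fin m) (Fin n) ℝ} {φ : ℝ → EReal}

/-- The block structure of a coderivative element at the nuclear norm subdifferential. -/
theorem blocks_eq_zero (hmn : m ≤ n) (hP : IsPolarPair X W) {G : Matrix (Fin m) (Fin n) ℝ}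
    (hleft : G * Xᵀ = 0) (hright : Xᵀ * G = 0)
    (hone : ∀ y, Wᵀ *ᵥ (W *ᵥ y) = y → (W *ᵥ y) ⬝ᵥ (G *ᵥ y) = 0)
    {U : Matrix (Fin m) (Fin m) ℝ} {V : Matrix (Fin n) (Fin n) ℝ} (h : (U, V) ∈ svdPairs (X + W)) :
    (∀ i ∈ idxAlpha (X + W), ∀ j, (Uᵀ * G * V) i j = 0) ∧
    (∀ i, ∀ j ∈ idxAlpha (X + W), (Uᵀ * G * V) i (Fin.castLE hmn j) = 0) ∧
    ∀ i ∈ idxBeta (X + W), ∀ j ∈ idxBeta (X + W),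
      (Uᵀ * G * V) i (Fin.castLE hmn j) + (Uᵀ * G * V) j (Fin.castLE hmn i) = 0 := by
  have hM : ∀ i j, (Uᵀ * G * V) i j = U.col i ⬝ᵥ G *ᵥ V.col j := fun i j => by
    rw [Matrix.mul_assoc]; rfl
  have hZ := mulVec_col_of_mem_svdPairs hmn h
  have hs := sv_nonneg (X + W)
  refine ⟨fun i hi j => ?_, fun i j hj => ?_, fun i hi j hj => ?_⟩
  · have h1 : 1 < sv (X + W) i := hi
    have h2 := (hP.mulVec_of_singular (hs i) (hZ i).1 (hZ i).2).1
    rw [max_eq_left (by linarith)] at h2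
    have h3 : (sv (X + W) i - 1) • Gᵀ *ᵥ U.col i = 0 := by
      rw [← mulVec_smul, ← h2, mulVec_mulVec, ← transpose_transpose (Gᵀ * X), transpose_mul,
        transpose_transpose, hright, transpose_zero, zero_mulVec]
    rw [hM, dotProduct_mulVec_eq, (smul_eq_zero.1 h3).resolve_left (by linarith), zero_dotProduct]
  · have h1 : 1 < sv (X + W) j := hj
    have h2 := (hP.transpose_mulVec_of_singular (hs j) (hZ j).1 (hZ j).2).1
    rw [max_eq_left (by linarith)] at h2
    have h3 : (sv (X + W) j - 1) • G *ᵥ V.col (Fin.castLE hmn j) = 0 := by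
      rw [← mulVec_smul, ← h2, mulVec_mulVec, hleft, zero_mulVec]
    rw [hM, (smul_eq_zero.1 h3).resolve_left (by linarith), dotProduct_zero]
  · have hβ : ∀ k ∈ idxBeta (X + W), W *ᵥ V.col (Fin.castLE hmn k) = U.col k ∧
        Wᵀ *ᵥ U.col k = V.col (Fin.castLE hmn k) := by
      intro k hk
      have h1 : sv (X + W) k = 1 := hk
      have h2 := (hP.mulVec_of_singular (hs k) (hZ k).1 (hZ k).2).2
      have h3 := (hP.transpose_mulVec_of_singular (hs k) (hZ k).1 (hZ k).2).2
      rw [h1, min_self, one_smul] at h2 h3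
      exact ⟨h2, h3⟩
    obtain ⟨hi1, hi2⟩ := hβ i hi
    obtain ⟨hj1, hj2⟩ := hβ j hj
    have e1 := hone (V.col (Fin.castLE hmn i)) (by rw [hi1, hi2])
    have e2 := hone (V.col (Fin.castLE hmn j)) (by rw [hj1, hj2])
    -- Polarization: the form vanishes at both columns and at their sum.
    have e3 := hone (V.col (Fin.castLE hmn i) + V.col (Fin.castLE hmn j))
      (by rw [mulVec_add, mulVec_add, hi1, hi2, hj1, hj2])
    rw [mulVec_add, mulVec_add, hi1, hj1, add_dotProduct, dotProduct_add, dotProduct_add] at e3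
    rw [hi1] at e1
    rw [hj1] at e2
    rw [hM, hM]
    linarith

/-- A singular pair `(a, b)` of value `s` in `(0, 1)` is also one of `W`. There the sandwich
identity reads `(1 - s²)² (a ⬝ D b) = 0`, whereas `s (a ⬝ D b) = s φ'(s) |b|²`. -/
theorem idxGamma1_eq_empty (hmn : m ≤ n) (hφ : IsL1 φ) (hP : IsPolarPair X W)
    (hD : D ∈ subdiff (phiHatSv φ) W) (hmid : (1 - W * Wᵀ) * D * (1 - Wᵀ * W) = 0)
    (h : ∀ t ∈ Set.Ioo (0 : ℝ) 1, deriv (fun s => (φ s).toReal) t ≠ 0) :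
    idxGamma1 (X + W) = ∅ := by
  rw [Set.eq_empty_iff_forall_notMem]
  rintro i ⟨hs0, hs1⟩
  obtain ⟨a, ha, hZ⟩ := exists_left_singular_vector hmn (X + W) i
  set s := sv (X + W) i
  obtain ⟨b, hb⟩ : ∃ b, b = s⁻¹ • (X + W)ᵀ *ᵥ a := ⟨_, rfl⟩
  have h1 : (X + W) *ᵥ b = s • a := by
    rw [hb, mulVec_smul, hZ, smul_smul]
    congr 1
    field_simp
  have h2 : (X + W)ᵀ *ᵥ a = s • b := by rw [hb, smul_smul, mul_inv_cancel₀ hs0.ne', one_smul]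
  have hWb := (hP.mulVec_of_singular hs0.le h1 h2).2
  have hWa := (hP.transpose_mulVec_of_singular hs0.le h1 h2).2
  rw [min_eq_left hs1.le] at hWb hWa
  have hb0 : b ≠ 0 := fun h0 => by
    rw [h0, mulVec_zero] at h1
    exact (smul_ne_zero hs0.ne' ha) h1.symm
  have hs2 : 1 - s ^ 2 ≠ 0 := by nlinarith
  have e1 : (1 - Wᵀ * W) *ᵥ b = (1 - s ^ 2) • b := by
    rw [sub_mulVec, one_mulVec, ← mulVec_mulVec, hWb, mulVec_smul, hWa]
    module
  have e2 : (1 - W * Wᵀ)ᵀ *ᵥ a = (1 - s ^ 2) • a := by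
    rw [transpose_sub, transpose_one, transpose_mul, transpose_transpose, sub_mulVec, one_mulVec,
      ← mulVec_mulVec, hWa, mulVec_smul, hWb]
    module
  have e3 : a ⬝ᵥ ((1 - W * Wᵀ) * D * (1 - Wᵀ * W)) *ᵥ b = 0 := by
    rw [hmid, zero_mulVec, dotProduct_zero]
  rw [← mulVec_mulVec, e1, ← mulVec_mulVec, dotProduct_mulVec_eq, e2, mulVec_smul, smul_dotProduct,
    dotProduct_smul, smul_eq_mul, smul_eq_mul] at e3
  have e4 : a ⬝ᵥ D *ᵥ b = 0 := by simpa [hs2] using e3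
  have e5 := hφ.dotProduct_eq_of_mem_subdiff hmn hD (s := s) (y := b) ⟨hs0, hs1.le⟩
    (by rw [hWb, mulVec_smul, hWa, smul_smul, pow_two])
  rw [hWb, smul_dotProduct, e4, smul_zero] at e5
  have hbb : b ⬝ᵥ b ≠ 0 := fun h0 => hb0 (dotProduct_self_eq_zero.1 h0)
  exact mul_ne_zero (mul_ne_zero hs0.ne' (h s ⟨hs0, hs1⟩)) hbb e5.symm

/-- A left null vector `a` of `X + W` is one of `W`. The transposed sandwich identity at `a` is `(1
- Wᵀ W) Dᵀ a = 0`, and `W Dᵀ a = D Wᵀ a = 0`, so `Dᵀ a = 0` as well. -/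
theorem idxGamma0_eq_empty (hmn : m ≤ n) (hφ : IsL φ) (hP : IsPolarPair X W)
    (hD : D ∈ subdiff (phiHatSv φ) W) (hmid : (1 - W * Wᵀ) * D * (1 - Wᵀ * W) = 0)
    (h : (0 : ℝ) ∉ subdiff (phiHat φ) 0) : idxGamma0 (X + W) = ∅ := by
  rw [Set.eq_empty_iff_forall_notMem]
  intro i hi
  have hs : sv (X + W) i = 0 := hi
  obtain ⟨a, ha, hZ⟩ := exists_left_singular_vector hmn (X + W) i
  rw [hs, zero_pow two_ne_zero, zero_smul] at hZ
  have h1 : (X + W)ᵀ *ᵥ a = 0 := by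
    rw [← dotProduct_self_eq_zero, ← dotProduct_mulVec_eq, hZ, dotProduct_zero]
  have hWa : Wᵀ *ᵥ a = 0 := by
    simpa using (hP.transpose_mulVec_of_singular (a := a) (b := 0) (s := 0) le_rfl (by simp)
      (by rw [h1, zero_smul])).2
  refine ha (hφ.eq_zero_of_mem_subdiff hmn h hD hWa ?_)
  have e1 : (1 - Wᵀ * W) * Dᵀ * (1 - W * Wᵀ) = 0 := by
    have := congrArg Matrix.transpose hmid
    simpa [transpose_mul, Matrix.mul_assoc] using this
  have e2 : W * Dᵀ = D * Wᵀ := by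
    rw [← mul_transpose_symm_of_mem_subdiff hmn hD, transpose_mul, transpose_transpose]
  have e3 : ((1 - Wᵀ * W) * Dᵀ * (1 - W * Wᵀ)) *ᵥ a = 0 := by rw [e1, zero_mulVec]
  have e4 : (1 - W * Wᵀ) *ᵥ a = a := by
    rw [sub_mulVec, one_mulVec, ← mulVec_mulVec, hWa, mulVec_zero, sub_zero]
  rw [← mulVec_mulVec, e4, Matrix.sub_mul, Matrix.one_mul, Matrix.mul_assoc, e2, sub_mulVec,
    ← mulVec_mulVec, ← mulVec_mulVec, hWa, mulVec_zero, mulVec_zero, sub_zero] at e3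
  exact e3

end MStationary

end RankReg

theorem mainTheorem2 {m n : ℕ} (hmn : m ≤ n) (ν : ℝ) (hν : 0 < ν)
    (f : Matrix (Fin m) (Fin n) ℝ → ℝ) (Ω : Set (Matrix (Fin m) (Fin n) ℝ))
    (hΩ_closed : IsClosed Ω) (hΩ_convex : Convex ℝ Ω)
    (hf_lip : LocallyLipschitz f)
    (hf_reg : ∀ X ∈ Ω,
      RankReg.regularSubdiff (fun Y : Matrix (Fin m) (Fin n) ℝ => ((f Y : ℝ) : EReal)) X =
        RankReg.subdiff (fun Y : Matrix (Fin m) (Fin n) ℝ => ((f Y : ℝ) : EReal)) X)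
    (φ : ℝ → EReal) (hφ : RankReg.IsL1 φ)
    (X : Matrix (Fin m) (Fin n) ℝ) (hX : RankReg.IsMStationary ν f Ω φ X) :
    ∃ W ∈ RankReg.nuclearSubdiff X, ∃ ΔΓ ∈ RankReg.costSet ν f Ω X,
      (∀ U V, (U, V) ∈ RankReg.svdPairs (X + W) →
        let M : Matrix (Fin m) (Fin n) ℝ := U.transpose * ΔΓ * V
        let α := RankReg.idxAlpha (X + W)
        let β := RankReg.idxBeta (X + W)
        let γ := RankReg.idxGamma (X + W)
        let c := RankReg.idxC m n
        ΔΓ = U * M * V.transpose ∧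
        RankReg.block M α (RankReg.asCols hmn α) = 0 ∧
        RankReg.block M α (RankReg.asCols hmn β) = 0 ∧
        RankReg.block M α (RankReg.asCols hmn γ) = 0 ∧
        RankReg.block M α c = 0 ∧
        RankReg.block M β (RankReg.asCols hmn α) = 0 ∧
        RankReg.block M γ (RankReg.asCols hmn α) = 0 ∧
        RankReg.symPart (RankReg.sqBlock hmn M β) = 0) ∧
      ((∀ t ∈ Set.Ioo (0 : ℝ) 1, deriv (fun s => (φ s).toReal) t ≠ 0) →
        RankReg.idxGamma1 (X + W) = ∅) ∧
      ((0 : ℝ) ∉ RankReg.subdiff (RankReg.phiHat φ) 0 →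
        RankReg.idxGamma0 (X + W) = ∅) := by
  obtain ⟨W, hW, D, hD, G, hG, u, hN, hGu⟩ := hX
  have hP := (RankReg.mem_nuclearSubdiff_iff hmn).1 hW
  have hu : u = -G := (neg_eq_of_add_eq_zero_right hGu).symm
  subst hu
  have hDl := RankReg.mul_transpose_symm_of_mem_subdiff hmn hD
  have hDr := RankReg.transpose_mul_symm_of_mem_subdiff hmn hD
  have hleft := RankReg.normal_mul_transpose_eq_zero hmn hP hN
    (by rw [Matrix.neg_mul, Matrix.transpose_neg, hDl])
  have hright := RankReg.normal_transpose_mul_eq_zero hmn hP hN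
    (by rw [Matrix.neg_mul, Matrix.transpose_neg, hDl])
    (by rw [Matrix.mul_neg, Matrix.transpose_neg, hDr])
  have hmid := RankReg.normal_mul_mul_eq_zero hmn hN
  rw [Matrix.neg_mul, neg_eq_zero] at hleft
  rw [Matrix.mul_neg, neg_eq_zero] at hright
  rw [Matrix.mul_neg, Matrix.neg_mul, neg_eq_zero] at hmid
  have hone : ∀ y, W.transpose.mulVec (W.mulVec y) = y →
      dotProduct (W.mulVec y) (G.mulVec y) = 0 := by
    intro y hy
    -- The second component of the normal is `-D`, whose form at `p` is `-φ'(1) |p|²`; it can be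
    -- nonnegative only for `p = 0`.
    have h1 := RankReg.normal_dotProduct_eq_zero_of_neg hmn hN (fun p hp hneg => by
      have h2 := hφ.dotProduct_eq_of_mem_subdiff hmn hD (s := 1) (y := p) ⟨one_pos, le_rfl⟩
        (by rw [hp, one_pow, one_smul])
      rw [Matrix.neg_mulVec, dotProduct_neg, h2, one_mul] at hneg
      rw [← dotProduct_self_eq_zero]
      nlinarith [hφ.deriv_one_pos, RankReg.dotProduct_self_nonneg' p]) hy
    rwa [Matrix.neg_mulVec, dotProduct_neg, neg_eq_zero] at h1
  refine ⟨W, hW, G, hG, fun U V hUV => ?_, RankReg.idxGamma1_eq_empty hmn hφ hP hD hmid,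
    RankReg.idxGamma0_eq_empty hmn hφ.toIsL hP hD hmid⟩
  obtain ⟨hrow, hcol, hsym⟩ := RankReg.blocks_eq_zero hmn hP hleft hright hone hUV
  have hU := RankReg.self_mul_transpose_of_mem_orthogonalGroup hUV.1
  have hV := RankReg.self_mul_transpose_of_mem_orthogonalGroup hUV.2.1
  have hrow' : ∀ J, RankReg.block (U.transpose * G * V) (RankReg.idxAlpha (X + W)) J = 0 := by
    intro J
    ext i j
    exact hrow i i.2 j
  have hcol' : ∀ I, RankReg.block (U.transpose * G * V) I
      (RankReg.asCols hmn (RankReg.idxAlpha (X + W))) = 0 := by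
    intro I
    ext i ⟨j, k, hk, rfl⟩
    exact hcol i k hk
  refine ⟨?_, hrow' _, hrow' _, hrow' _, hrow' _, hcol' _, hcol' _, ?_⟩
  · calc G = (U * U.transpose) * G * (V * V.transpose) := by
          rw [hU, hV, Matrix.one_mul, Matrix.mul_one]
      _ = U * (U.transpose * G * V) * V.transpose := by simp only [Matrix.mul_assoc]
  · ext i j
    have := hsym i i.2 j j.2
    simp only [RankReg.symPart, RankReg.sqBlock, Matrix.smul_apply, Matrix.add_apply,
      Matrix.transpose_apply, Matrix.submatrix_apply, this, smul_zero, Matrix.zero_apply]
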